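/- Let $A\in\mathbb R^{m\times d}$ have full rank $m\le d$, let $b\in\mathbb R^m$, $c\in\mathbb R^d$, and consider the linear program $(\mathrm P_b)$: minimize $c^Tx$ subject to $Ax=b$, $x\ge 0$; write $\mathrm{OPT}(b)$ for its set of optimal solutions. A basis is a set $I\subseteq\{1,\dots,d\}$ with $|I|=m$ such that the submatrix $A_I$ of the columns indexed by $I$ is invertible; put $\lambda(I)=A_I^{-T}c_I$ and, for $v\in\mathbb R^m$, let $x(I,v)\in\mathbb R^d$ be the vector equal to $A_I^{-1}v$ on the coordinates in $I$ and to $0$ elsewhere. A basis is dual feasible if $\lambda(I)^TA\le c^T$. Let $I_1,\dots,I_N$ be all dual feasible bases, numbered so that $x(I_k,b)\ge 0$ exactly for $k\le K$. Assume: (A2) $(\mathrm P_b)$ has exactly one optimal solution $x^\star(b)$. (B1) $m_0\le m$, $r_n\to\infty$, and $b_n$ are random vectors in $\mathbb R^m$ whose last $m-m_0$ coordinates equal those of $b$, such that $G_n:=r_n(b_n-b)$ converges in distribution to $G=(G^{m_0},0)$, where the law of $G^{m_0}$ is absolutely continuous with respect to Lebesgue measure on $\mathbb R^{m_0}$. (B2)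 $\mathbb P(\mathrm{OPT}(b_n)\neq\emptyset)\to 1$. Let $x^\star(b_n)$ be any measurable choice of an element of $\mathrm{OPT}(b_n)$ (with arbitrary values where this set is empty). For $k\le K$ let $$H_k=\{v\in\mathbb R^{m_0}: x_i(I_k,(v,0))\ge 0 \text{ for all } i\in I_k\setminus \mathrm{supp}\,x^\star(b)\}.$$ Then each $H_k$ is a closed convex cone, and it is an intersection of $m-|\mathrm{supp}\,x^\star(b)|$ sets of the form $\{v\in\mathbb R^{m_0}:a^Tv\ge0\}$, where $a\ne0$ if $m_0=m$ (if $m_0<m$, some $a$ may be $0$, in which case the set is all of $\mathbb R^{m_0}$). Moreover: (i) For every non-empty $\mathcal K\subseteq\{1,\dots,K\}$ let $\alpha_n^{\mathcal K}$ be random weights in the unit simplex $\Delta_{|\mathcal K|}$ such that $x^\star(b_n)=\sum_{k\in\mathcal K}(\alpha_n^{\mathcal K})_k\,x(I_k,b_n)$ on the event that $\mathcal K$ is exactly the set of $k\in\{1,\dots,N\}$ with $x(I_k,b_n)\ge0$, and suppose that for each such $\mathcal K$ the pair $(\alpha_n^{\mathcal K},G_n)$ converges in distribution to $(\alpha^{\mathcal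 K},G)$ on $\Delta_{|\mathcal K|}\times\mathbb R^m$. Then $$r_n\bigl(x^\star(b_n)-x^\star(b)\bigr)\xrightarrow{D} M(G^{m_0}):=\sum_{\emptyset\ne\mathcal K\subseteq\{1,\dots,K\}}\mathbb 1\Bigl\{G^{m_0}\in\bigcap_{k\in\mathcal K}H_k\setminus\bigcup_{k\le K,\,k\notin\mathcal K}H_k\Bigr\}\sum_{k\in\mathcal K}(\alpha^{\mathcal K})_k\,x(I_k,G).$$ (ii) If $x^\star(b)$ is nondegenerate, i.e. it does not have fewer than $m$ nonzero coordinates, then $K=1$, $I_1$ is the unique basis $I$ with $x(I,b)=x^\star(b)$, and (without any assumption on weights) $$r_n\bigl(x^\star(b_n)-x^\star(b)\bigr)\xrightarrow{D}x(I_1,G).$$ The map $v\mapsto x(I_1,v)$ is linear and invertible from $\mathbb R^m$ onto $\{x\in\mathbb R^d: x_i=0\text{ for }i\notin I_1\}$, and $x(I_1,G)$ is Gaussian if $G$ is Gaussian. -/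

import Mathlib

open MeasureTheory ProbabilityTheory Filter Topology Matrix

noncomputable section

namespace LinProg

variable {m d m₀ : ℕ}

/-- Feasible set of the standard linear program: `A x = b`, `x ≥ 0`. -/
def feasSet (A : Matrix (Fin m) (Fin d) ℝ) (b : Fin m → ℝ) : Set (Fin d → ℝ) :=
  {x | A *ᵥ x = b ∧ 0 ≤ x}

/-- Optimality set: the minimizers of `cᵀ x` over the feasible set. -/
def optSet (A : Matrix (Fin m) (Fin d) ℝ) (c : Fin d → ℝ) (b : Fin m → ℝ) : Set (Fin d → ℝ) :=
  {x | x ∈ feasSet A b ∧ ∀ y ∈ feasSet A b, c ⬝ᵥ x ≤ c ⬝ᵥ y}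

/-- The square submatrix `A_I` formed by the `m` columns of `A` indexed by `I`, in increasing
order. -/
def colMat (A : Matrix (Fin m) (Fin d) ℝ) (I : Finset (Fin d)) (h : I.card = m) :
    Matrix (Fin m) (Fin m) ℝ :=
  A.submatrix id (I.orderEmbOfFin h)

/-- `I` is a basis: it has `m` elements and `A_I` is invertible. -/
def IsBasis (A : Matrix (Fin m) (Fin d) ℝ) (I : Finset (Fin d)) : Prop :=
  ∃ h : I.card = m, IsUnit (colMat A I h)

/-- Primal basic solution `x(I, v) = Aug_I (A_I⁻¹ v)`; it vanishes outside `I`.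
(Only used for bases; the value is `0` if `|I| ≠ m`.) -/
def primalSol (A : Matrix (Fin m) (Fin d) ℝ) (I : Finset (Fin d)) (v : Fin m → ℝ) : Fin d → ℝ :=
  if h : I.card = m then Function.extend (I.orderEmbOfFin h) ((colMat A I h)⁻¹ *ᵥ v) 0 else 0

/-- Dual basic solution `λ(I) = A_I⁻ᵀ c_I`. (Only used for bases.) -/
def dualSol (A : Matrix (Fin m) (Fin d) ℝ) (c : Fin d → ℝ) (I : Finset (Fin d)) : Fin m → ℝ :=
  if h : I.card = m then ((colMat A I h)⁻¹)ᵀ *ᵥ (c ∘ I.orderEmbOfFin h) else 0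

/-- `I` is a dual feasible basis: `λ(I)ᵀ A ≤ cᵀ`. -/
def IsDualFeasibleBasis (A : Matrix (Fin m) (Fin d) ℝ) (c : Fin d → ℝ) (I : Finset (Fin d)) :
    Prop :=
  IsBasis A I ∧ dualSol A c I ᵥ* A ≤ c

open Classical in
/-- The bases `I₁, …, I_K` that are both primal and dual feasible for right-hand side `b`. -/
def optBases (A : Matrix (Fin m) (Fin d) ℝ) (c : Fin d → ℝ) (b : Fin m → ℝ) :
    Finset (Finset (Fin d)) :=
  Finset.univ.filter fun I => IsDualFeasibleBasis A c I ∧ 0 ≤ primalSol A I b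

/-- Support of a vector. -/
def supp (x : Fin d → ℝ) : Finset (Fin d) :=
  Finset.univ.filter fun i => x i ≠ 0

/-- A basic feasible solution of a program with `m` equality constraints is degenerate if fewer
than `m` of its coordinates are nonzero. -/
def IsDegenerate (m : ℕ) (x : Fin d → ℝ) : Prop :=
  (supp x).card < m

/-- The vector in `ℝ^m` whose first `m₀` coordinates are those of `v` and whose remaining
coordinates are those of `b`. -/
def overwrite (b : Fin m → ℝ) (v : Fin m₀ → ℝ) : Fin m → ℝ :=
  fun i => if h : (i : ℕ) < m₀ then v ⟨i, h⟩ else b i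

/-- The first `m₀` coordinates of a vector in `ℝ^m`. -/
def firstCoords (hm : m₀ ≤ m) (b : Fin m → ℝ) : Fin m₀ → ℝ :=
  fun j => b (Fin.castLE hm j)

/-- The cone `H_I ⊆ ℝ^{m₀}` attached to a basis `I` and the optimal solution `x`:
all `v` such that `x(I, (v, 0))` is nonnegative at the indices of `I` where `x` vanishes. -/
def limitCone (m₀ : ℕ) (A : Matrix (Fin m) (Fin d) ℝ) (x : Fin d → ℝ) (I : Finset (Fin d)) :
    Set (Fin m₀ → ℝ) :=
  {v | ∀ i ∈ I \ supp x, 0 ≤ primalSol A I (overwrite 0 v) i}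

/-- `H` is the intersection of a family of `D` closed half-spaces `{v | 0 ≤ aᵀ v}` whose bounding
hyperplanes pass through the origin. A normal vector `a` may be zero (giving the full space) unless
`m₀ = m`. -/
def IsInterHalfSpaces (m D : ℕ) (H : Set (Fin m₀ → ℝ)) : Prop :=
  ∃ a : Fin D → Fin m₀ → ℝ, (m₀ = m → ∀ j, a j ≠ 0) ∧ H = ⋂ j, {v | 0 ≤ a j ⬝ᵥ v}

/-- The weighted sum `α ⊗ x(I_𝒦, v) = ∑_{I ∈ 𝒦} α_I x(I, v)`. -/
def weightedSol (A : Matrix (Fin m) (Fin d) ℝ) (𝒦 : Finset (Finset (Fin d))) (α : 𝒦 → ℝ)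
    (v : Fin m → ℝ) : Fin d → ℝ :=
  ∑ I : 𝒦, α I • primalSol A I v

/-- The dual feasible bases that are primal feasible for the right-hand side `v` are precisely
those in `𝒦`. -/
def ActiveBases (A : Matrix (Fin m) (Fin d) ℝ) (c : Fin d → ℝ) (𝒦 : Finset (Finset (Fin d)))
    (v : Fin m → ℝ) : Prop :=
  optBases A c v = 𝒦

/-- The cell `H_𝒦 ∖ ⋃_{I ∉ 𝒦} H_I`, where `H_𝒦 = ⋂_{I ∈ 𝒦} H_I` and `I` ranges over `ℬ`. -/
def limitCell (m₀ : ℕ) (A : Matrix (Fin m) (Fin d) ℝ) (x : Fin d → ℝ)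
    (ℬ 𝒦 : Finset (Finset (Fin d))) : Set (Fin m₀ → ℝ) :=
  (⋂ I ∈ 𝒦, limitCone m₀ A x I) \ ⋃ I ∈ ℬ \ 𝒦, limitCone m₀ A x I

/-- The limit `M`: the sum over all nonempty `𝒦 ⊆ ℬ` of
`𝟙{g ∈ H_𝒦 ∖ ⋃_{I ∉ 𝒦} H_I} α^𝒦 ⊗ x(I_𝒦, (g, 0))`. -/
def limitM (A : Matrix (Fin m) (Fin d) ℝ) (x : Fin d → ℝ) (ℬ : Finset (Finset (Fin d)))
    (α : (𝒦 : Finset (Finset (Fin d))) → 𝒦 → ℝ) (g : Fin m₀ → ℝ) : Fin d → ℝ :=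
  ∑ 𝒦 ∈ ℬ.powerset.filter (fun 𝒦 => 𝒦.Nonempty),
    (limitCell m₀ A x ℬ 𝒦).indicator (fun g => weightedSol A 𝒦 (α 𝒦) (overwrite 0 g)) g

end LinProg

end

open LinProg

/-! The deterministic core is linear programming duality. A right-hand side `w` admits an optimal
solution exactly when some dual feasible basis `I` has x(I, w) ≥ 0 (`optSet_nonempty_iff`). The hard
direction takes a dual certificate from Farkas' lemma, moves it to a vertex of the dual polyhedron,
and completes the columns used by a primal solution to a basis among the tight columns.

Near `b` only bases optimal at `b` can be optimal, and all of them give x(I, b) = x⋆. Their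
coordinates on the support of x⋆ stay positive, so optimality of I at `w` depends only on the signs
of the remaining coordinates, that is, on whether the increment `w - b` lies in the cone H_I. Cones
are scale invariant, so the cell containing G_n records the set of active bases. As weights sum to
one and x(I, ·) is linear, r_n(x⋆(b_n) - x⋆) equals M evaluated at the weights α_n and at G_n,
outside an event of vanishing probability (`smul_sub_eq_limitM`, `tendsto_measure_exceptional`).

M is discontinuous, but only across boundaries of convex cones, which are Lebesgue null and hence
not charged by the law of G. The cells partition the space, so the closed-set form of the
portmanteau theorem can be applied cell by cell (`tendstoInDistribution_of_pieces`); convergence of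
each pair (α_n^𝒦, G_n) suffices, without joint convergence over 𝒦.

If x⋆ is nondegenerate, I₁ is its support, so x(I₁, ·) stays feasible near `b` and is then the only
optimal solution there. Linearity and continuous mapping give the limit. -/

open scoped ENNReal

namespace LinProg

/-! ### Finitely generated cones: Carathéodory and Farkas -/

section Cone

variable {ι E : Type*} [Fintype ι] [AddCommGroup E] [Module ℝ E]

/-- The reduction step of the conic Carathéodory theorem. -/
theorem exists_nonneg_combination_card_lt (v : ι → E) {t : ι → ℝ} (ht : 0 ≤ t)
    (hdep : ¬ LinearIndepOn ℝ v ↑(Finset.univ.filter fun i => t i ≠ 0)) :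
    ∃ t' : ι → ℝ, 0 ≤ t' ∧ ∑ i, t' i • v i = ∑ i, t i • v i ∧ (∀ i, t i = 0 → t' i = 0) ∧
      (Finset.univ.filter fun i => t' i ≠ 0).card < (Finset.univ.filter fun i => t i ≠ 0).card := by
  -- A linear dependence supported where `t` is nonzero, with its sign chosen so that some
  -- coefficient is positive.
  obtain ⟨g, hg, hgs, hpos⟩ : ∃ g : ι → ℝ, ∑ i, g i • v i = 0 ∧ (∀ i, t i = 0 → g i = 0) ∧
      ∃ i, 0 < g i := by
    rw [linearIndepOn_finset_iff] at hdep
    push Not at hdep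
    obtain ⟨f, hf, i, hi, hfi⟩ := hdep
    let g : ι → ℝ := fun i => if t i ≠ 0 then f i else 0
    have hg : ∑ i, g i • v i = 0 := by
      rw [← hf, Finset.sum_filter]
      exact Finset.sum_congr rfl fun j _ => by by_cases h : t j = 0 <;> simp [g, h]
    have hgs : ∀ i, t i = 0 → g i = 0 := fun j hj => by simp [g, hj]
    have hgi : g i ≠ 0 := by simpa [g, (Finset.mem_filter.1 hi).2] using hfi
    rcases lt_or_gt_of_ne hgi with h | h
    · exact ⟨-g, by simpa [Finset.sum_neg_distrib] using hg, fun j hj => by simp [hgs j hj], i,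
        by simpa using h⟩
    · exact ⟨g, hg, hgs, i, h⟩
  -- Ratio test: `t k / g k` is the largest multiple of `g` that can be subtracted while staying
  -- nonnegative, and it kills coordinate `k`.
  obtain ⟨k, hk, hmin⟩ := Finset.exists_min_image (Finset.univ.filter fun i => 0 < g i)
    (fun i => t i / g i) (by obtain ⟨i, hi⟩ := hpos; exact ⟨i, by simpa using hi⟩)
  have hk' : 0 < g k := by simpa using hk
  have htk : t k ≠ 0 := fun h => hk'.ne' (hgs k h)
  have hq : 0 ≤ t k / g k := div_nonneg (ht k) hk'.le
  have hs : ∀ i, t i = 0 → t i - t k / g k * g i = 0 := fun i hi => by simp [hi, hgs i hi]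
  refine ⟨fun i => t i - t k / g k * g i, fun i => ?_, ?_, hs, ?_⟩
  · rcases le_or_gt (g i) 0 with h | h
    · have := mul_nonpos_of_nonneg_of_nonpos hq h
      have := ht i
      simp only [Pi.zero_apply] at this ⊢
      linarith
    · have := hmin i (by simpa using h)
      simp only [Pi.zero_apply, sub_nonneg]
      exact (le_div_iff₀ h).1 this
  · simp only [sub_smul, Finset.sum_sub_distrib, mul_smul, ← Finset.smul_sum, hg, smul_zero,
      sub_zero]
  · refine Finset.card_lt_card (Finset.ssubset_iff_subset_ne.2 ⟨fun i hi => ?_, fun h => ?_⟩)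
    · simp only [Finset.mem_filter, Finset.mem_univ, true_and] at hi ⊢
      exact fun h => hi (hs i h)
    · have : k ∈ Finset.univ.filter fun i => t i - t k / g k * g i ≠ 0 := by
        rw [h]; simpa using htk
      simp [div_mul_cancel₀ _ hk'.ne'] at this

/-- **Carathéodory's theorem for cones**: a nonnegative combination can be rewritten using only
linearly independent vectors among those that occur in it. -/
theorem exists_nonneg_combination_linearIndepOn (v : ι → E) {t : ι → ℝ} (ht : 0 ≤ t) :
    ∃ t' : ι → ℝ, 0 ≤ t' ∧ ∑ i, t' i • v i = ∑ i, t i • v i ∧ (∀ i, t i = 0 → t' i = 0) ∧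
      LinearIndepOn ℝ v {i | t' i ≠ 0} := by
  induction hN : (Finset.univ.filter fun i => t i ≠ 0).card using Nat.strong_induction_on
    generalizing t with
  | _ N ih =>
    by_cases hdep : LinearIndepOn ℝ v ↑(Finset.univ.filter fun i => t i ≠ 0)
    · exact ⟨t, ht, rfl, fun _ h => h, by simpa using hdep⟩
    · obtain ⟨t₁, h0, h1, h2, h3⟩ := exists_nonneg_combination_card_lt v ht hdep
      obtain ⟨t₂, k0, k1, k2, k3⟩ := ih _ (hN ▸ h3) h0 rfl
      exact ⟨t₂, k0, k1.trans h1, fun i hi => k2 i (h2 i hi), k3⟩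

variable [TopologicalSpace E] [IsTopologicalAddGroup E] [ContinuousSMul ℝ E] [T2Space E]

/-- A finitely generated cone is closed. -/
theorem isClosed_nonneg_combinations (v : ι → E) :
    IsClosed {y | ∃ t : ι → ℝ, 0 ≤ t ∧ ∑ i, t i • v i = y} := by
  classical
  -- By Carathéodory the cone is a finite union of images of orthants under injective linear maps,
  -- which are closed embeddings.
  have key : {y | ∃ t : ι → ℝ, 0 ≤ t ∧ ∑ i, t i • v i = y} =
      ⋃ s : {s : Finset ι // LinearIndepOn ℝ v ↑s},
        Fintype.linearCombination ℝ (fun i : s.1 => v i) '' {t | 0 ≤ t} := by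
    ext y
    simp only [Set.mem_ofPred_eq, Set.mem_iUnion, Set.mem_image]
    constructor
    · rintro ⟨t, ht, rfl⟩
      obtain ⟨t', h0, h1, -, h3⟩ := exists_nonneg_combination_linearIndepOn v ht
      refine ⟨⟨Finset.univ.filter fun i => t' i ≠ 0, by simpa using h3⟩, fun i => t' i,
        fun i => h0 i, ?_⟩
      rw [← h1, Fintype.linearCombination_apply]
      dsimp only
      rw [Finset.sum_coe_sort (Finset.univ.filter fun i => t' i ≠ 0) (fun i => t' i • v i),
        Finset.sum_filter]
      exact Finset.sum_congr rfl fun j _ => by by_cases h : t' j = 0 <;> simp [h]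
    · rintro ⟨⟨s, hs⟩, t, ht, rfl⟩
      refine ⟨fun i => if h : i ∈ s then t ⟨i, h⟩ else 0, fun i => ?_, ?_⟩
      · by_cases h : i ∈ s
        · simpa [h] using ht ⟨i, h⟩
        · simp [h]
      · rw [Fintype.linearCombination_apply]
        rw [← Finset.sum_subset (Finset.subset_univ s) (fun i _ hi => by simp [hi]),
          ← Finset.sum_coe_sort]
        exact Finset.sum_congr rfl fun j _ => by simp
  rw [key]
  refine isClosed_iUnion_of_finite fun s => ?_
  refine (LinearMap.isClosedEmbedding_of_injective ?_).isClosedMap _ isClosed_Ici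
  exact LinearMap.ker_eq_bot.2 (s.2.linearIndependent.fintypeLinearCombination_injective)

/-- **Farkas' lemma** for a finitely generated cone. -/
theorem exists_separating_of_not_nonneg_combination [LocallyConvexSpace ℝ E] (v : ι → E) {y : E}
    (hy : ¬ ∃ t : ι → ℝ, 0 ≤ t ∧ ∑ i, t i • v i = y) :
    ∃ f : E →L[ℝ] ℝ, (∀ i, 0 ≤ f (v i)) ∧ f y < 0 := by
  classical
  let C : ProperCone ℝ E :=
    { carrier := {y | ∃ t : ι → ℝ, 0 ≤ t ∧ ∑ i, t i • v i = y}
      add_mem' := by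
        rintro _ _ ⟨t, ht, rfl⟩ ⟨u, hu, rfl⟩
        exact ⟨t + u, add_nonneg ht hu, by simp [add_smul, Finset.sum_add_distrib]⟩
      zero_mem' := ⟨0, le_rfl, by simp⟩
      smul_mem' := by
        rintro r _ ⟨t, ht, rfl⟩
        refine ⟨(r : ℝ) • t, smul_nonneg r.2 ht, ?_⟩
        simp only [Pi.smul_apply, smul_assoc, ← Finset.smul_sum]
        rfl
      isClosed' := isClosed_nonneg_combinations v }
  obtain ⟨f, hf, hfy⟩ := ProperCone.hyperplane_separation_point C (x₀ := y) hy
  exact ⟨f, fun i => hf _ ⟨Pi.single i 1, by simp [Pi.single_nonneg],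
    by simp [Pi.single_apply]⟩, hfy⟩

end Cone
end LinProg

namespace LinProg

/-! ### Strong duality and vertices of the dual polyhedron -/

section Duality

variable {m d : ℕ} {A : Matrix (Fin m) (Fin d) ℝ} {b : Fin m → ℝ} {c x : Fin d → ℝ}

/-- **Strong duality**: an optimal solution has a dual certificate. -/
theorem exists_dual_certificate (hx : x ∈ optSet A c b) :
    ∃ l : Fin m → ℝ, l ᵥ* A ≤ c ∧ c ⬝ᵥ x ≤ l ⬝ᵥ b := by
  obtain ⟨⟨hAx, hx0⟩, hopt⟩ := hx
  -- Generators: the columns with their costs, and the ray opposite to (b, optimal value). If (0,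
  -- -1) were in their cone, the program could be improved.
  let v : Option (Fin d) → (Fin m → ℝ) × ℝ := fun o =>
    o.elim (-b, -(c ⬝ᵥ x)) fun j => (A.col j, c j)
  have hnot : ¬ ∃ t : Option (Fin d) → ℝ, 0 ≤ t ∧ ∑ i, t i • v i = (0, -1) := by
    rintro ⟨t, ht, hsum⟩
    rw [Fintype.sum_option] at hsum
    set s := t none
    set u : Fin d → ℝ := fun j => t (some j)
    have hs : 0 ≤ s := ht none
    have hu : 0 ≤ u := fun j => ht (some j)
    have h1 : A *ᵥ u = s • b := by
      have := congrArg Prod.fst hsum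
      simp only [v, Option.elim, Prod.fst_add, Prod.smul_fst, Prod.fst_sum] at this
      rw [Matrix.mulVec_eq_sum]
      rw [smul_neg, neg_add_eq_zero] at this
      rw [this]
      exact Finset.sum_congr rfl fun j _ => by ext i; simp [u, Matrix.col, mul_comm]
    have h2 : c ⬝ᵥ u = s * (c ⬝ᵥ x) - 1 := by
      have := congrArg Prod.snd hsum
      simp only [v, Option.elim, Prod.snd_add, Prod.smul_snd, Prod.snd_sum, smul_eq_mul] at this
      have h : c ⬝ᵥ u = ∑ j, t (some j) * c j := by
        simp [dotProduct, u, mul_comm]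
      rw [h]; linarith
    have hs1 : 0 < 1 + s := by linarith
    -- Adding `x` makes the normalizing factor 1 + s positive even for s = 0, where `u` is only a
    -- recession direction. The resulting cost is the optimal one minus 1 / (1 + s).
    have := hopt ((1 + s)⁻¹ • (x + u)) ⟨by
      rw [Matrix.mulVec_smul, Matrix.mulVec_add, hAx, h1,
        show b + s • b = (1 + s) • b by rw [add_smul, one_smul], smul_smul,
        inv_mul_cancel₀ hs1.ne', one_smul],
      smul_nonneg (inv_nonneg.2 hs1.le) (add_nonneg hx0 hu)⟩
    rw [dotProduct_smul, dotProduct_add, h2, smul_eq_mul, ← div_eq_inv_mul, le_div_iff₀ hs1] at this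
    linarith
  obtain ⟨f, hf, hfy⟩ := exists_separating_of_not_nonneg_combination v hnot
  set q : ℝ := f (0, 1)
  let p : Fin m → ℝ := fun i => f (Pi.single i 1, 0)
  have hfp : ∀ w r, f (w, r) = p ⬝ᵥ w + q * r := fun w r => by
    have h1 : (w, r) = ∑ i, w i • ((Pi.single i 1 : Fin m → ℝ), (0 : ℝ)) + r • (0, 1) := by
      refine Prod.ext ?_ ?_
      · ext k
        simp [Prod.fst_sum, Finset.sum_apply, Pi.single_apply]
      · simp [Prod.snd_sum]
    rw [h1, map_add, map_sum, map_smul]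
    simp only [map_smul, smul_eq_mul, dotProduct, p, q, mul_comm]
  have hq : 0 < q := by
    rw [hfp] at hfy
    simpa using hfy
  refine ⟨-(q⁻¹ • p), fun j => ?_, ?_⟩
  · have := hf (some j)
    simp only [v, Option.elim, hfp] at this
    rw [Matrix.neg_vecMul, Matrix.smul_vecMul]
    have h : (p ᵥ* A) j = p ⬝ᵥ A.col j := rfl
    simp only [Pi.neg_apply, Pi.smul_apply, smul_eq_mul, h]
    rw [neg_le, ← div_eq_inv_mul, le_div_iff₀ hq]
    linarith
  · have := hf none
    simp only [v, Option.elim, hfp, dotProduct_neg] at this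
    rw [neg_dotProduct, smul_dotProduct, smul_eq_mul, le_neg, ← div_eq_inv_mul, div_le_iff₀ hq]
    linarith

theorem vecMul_injective_of_rank_eq (hA : A.rank = m) {l : Fin m → ℝ} (h : l ᵥ* A = 0) : l = 0 := by
  have hli : LinearIndependent ℝ A.row := by
    rw [linearIndependent_iff_card_eq_finrank_span, Set.finrank, ← Matrix.rank_eq_finrank_span_row,
      hA, Fintype.card_fin]
  exact Matrix.vecMul_injective_iff.2 hli (by simpa using h)

/-- If the columns of the tight constraints do not span, the dual solution can be moved so that
more constraints become tight. -/
theorem exists_more_tight (hA : A.rank = m) {l u : Fin m → ℝ} (hl : l ᵥ* A ≤ c) (hu : u ≠ 0)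
    (hut : ∀ j, (l ᵥ* A) j = c j → (u ᵥ* A) j = 0) :
    ∃ l' : Fin m → ℝ, l' ᵥ* A ≤ c ∧ (∀ j, (l ᵥ* A) j = c j → (l' ᵥ* A) j = c j) ∧
      ∃ j, (l ᵥ* A) j ≠ c j ∧ (l' ᵥ* A) j = c j := by
  wlog hpos : ∃ j, 0 < (u ᵥ* A) j generalizing u
  · obtain ⟨j, hj⟩ : ∃ j, (u ᵥ* A) j ≠ 0 := by
      by_contra! h
      exact hu (vecMul_injective_of_rank_eq hA (funext h))
    refine this (u := -u) (neg_ne_zero.2 hu) (fun k hk => ?_) ⟨j, ?_⟩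
    · simp [Matrix.neg_vecMul, hut k hk]
    · push Not at hpos
      simpa [Matrix.neg_vecMul] using lt_of_le_of_ne (hpos j) hj
  -- Ratio test again: `k` is the first constraint to become tight when moving from `l` along `u`.
  obtain ⟨k, hk, hmin⟩ := Finset.exists_min_image (Finset.univ.filter fun j => 0 < (u ᵥ* A) j)
    (fun j => (c j - (l ᵥ* A) j) / (u ᵥ* A) j)
    (by obtain ⟨i, hi⟩ := hpos; exact ⟨i, by simpa using hi⟩)
  have hk' : 0 < (u ᵥ* A) k := by simpa using hk
  set s := (c k - (l ᵥ* A) k) / (u ᵥ* A) k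
  have hs : 0 ≤ s := div_nonneg (sub_nonneg.2 (hl k)) hk'.le
  have hform : ∀ j, ((l + s • u) ᵥ* A) j = (l ᵥ* A) j + s * (u ᵥ* A) j := fun j => by
    simp [Matrix.add_vecMul, Matrix.smul_vecMul]
  refine ⟨l + s • u, fun j => ?_, fun j hj => ?_, k, fun h => hk'.ne' (hut k h), ?_⟩
  · rw [hform]
    rcases le_or_gt ((u ᵥ* A) j) 0 with h | h
    · have := mul_nonpos_of_nonneg_of_nonpos hs h
      have := hl j
      linarith
    · have := (le_div_iff₀ h).1 (hmin j (by simpa using h))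
      linarith
  · rw [hform, hj, hut j hj, mul_zero, add_zero]
  · rw [hform, div_mul_cancel₀ _ hk'.ne']
    ring

/-- Every dual feasible point can be moved to a vertex of the dual polyhedron with no fewer tight
constraints. -/
theorem exists_dual_vertex (hA : A.rank = m) {l : Fin m → ℝ} (hl : l ᵥ* A ≤ c) :
    ∃ l' : Fin m → ℝ, l' ᵥ* A ≤ c ∧ (∀ j, (l ᵥ* A) j = c j → (l' ᵥ* A) j = c j) ∧
      ∀ u : Fin m → ℝ, (∀ j, (l' ᵥ* A) j = c j → (u ᵥ* A) j = 0) → u = 0 := by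
  induction hN : (Finset.univ.filter fun j => (l ᵥ* A) j ≠ c j).card using Nat.strong_induction_on
    generalizing l with
  | _ N ih =>
    by_cases h : ∀ u : Fin m → ℝ, (∀ j, (l ᵥ* A) j = c j → (u ᵥ* A) j = 0) → u = 0
    · exact ⟨l, hl, fun _ h => h, h⟩
    · push Not at h
      obtain ⟨u, hut, hu⟩ := h
      obtain ⟨l₁, h0, h1, k, hk, hk'⟩ := exists_more_tight hA hl hu hut
      obtain ⟨l₂, g0, g1, g2⟩ := ih (Finset.univ.filter fun j => (l₁ ᵥ* A) j ≠ c j).card (by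
        rw [← hN]
        refine Finset.card_lt_card (Finset.ssubset_iff_subset_ne.2 ⟨fun i hi => ?_, fun h => ?_⟩)
        · simp only [Finset.mem_filter, Finset.mem_univ, true_and] at hi ⊢
          exact fun h => hi (h1 i h)
        · have : k ∈ Finset.univ.filter fun j => (l₁ ᵥ* A) j ≠ c j := by
            rw [h]; simpa using hk
          simp [hk'] at this) h0 rfl
      exact ⟨l₂, g0, fun j hj => g1 j (h1 j hj), g2⟩

end Duality

/-! ### Basic solutions and the fundamental theorem of linear programming -/

section Basis

variable {m d : ℕ} {A : Matrix (Fin m) (Fin d) ℝ} {I : Finset (Fin d)} {c : Fin d → ℝ}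

theorem mulVec_eq_colMat_mulVec (h : I.card = m) {x : Fin d → ℝ} (hx : ∀ i ∉ I, x i = 0) :
    A *ᵥ x = colMat A I h *ᵥ (x ∘ I.orderEmbOfFin h) := by
  ext i
  simp only [Matrix.mulVec, dotProduct, colMat, Matrix.submatrix_apply, id, Function.comp]
  rw [← Finset.sum_subset (Finset.subset_univ I) (fun j _ hj => by simp [hx j hj])]
  refine Eq.trans ?_ (Finset.sum_image (s := Finset.univ) (f := fun j => A i j * x j)
    fun a _ b _ hab => (I.orderEmbOfFin h).injective hab)
  rw [Finset.image_orderEmbOfFin_univ I h]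

theorem primalSol_of_card (h : I.card = m) (v : Fin m → ℝ) :
    primalSol A I v = Function.extend (I.orderEmbOfFin h) ((colMat A I h)⁻¹ *ᵥ v) 0 := by
  simp [primalSol, h]

theorem primalSol_orderEmbOfFin (h : I.card = m) (v : Fin m → ℝ) (k : Fin m) :
    primalSol A I v (I.orderEmbOfFin h k) = ((colMat A I h)⁻¹ *ᵥ v) k := by
  rw [primalSol_of_card h, (I.orderEmbOfFin h).injective.extend_apply]

theorem primalSol_eq_zero_of_notMem (v : Fin m → ℝ) {i : Fin d} (hi : i ∉ I) :
    primalSol A I v i = 0 := by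
  by_cases h : I.card = m
  · rw [primalSol_of_card h, Function.extend_apply']
    · rfl
    · rintro ⟨k, rfl⟩
      exact hi (I.orderEmbOfFin_mem h k)
  · simp [primalSol, h]

theorem isLinearMap_primalSol (A : Matrix (Fin m) (Fin d) ℝ) (I : Finset (Fin d)) :
    IsLinearMap ℝ (primalSol A I) := by
  by_cases h : I.card = m
  · constructor
    · intro v w
      ext i
      by_cases hi : i ∈ I
      · rw [← Finset.mem_coe, ← Finset.range_orderEmbOfFin I h] at hi
        obtain ⟨k, rfl⟩ := hi
        simp [primalSol_orderEmbOfFin, Matrix.mulVec_add]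
      · simp [primalSol_eq_zero_of_notMem _ hi]
    · intro t v
      ext i
      by_cases hi : i ∈ I
      · rw [← Finset.mem_coe, ← Finset.range_orderEmbOfFin I h] at hi
        obtain ⟨k, rfl⟩ := hi
        simp [primalSol_orderEmbOfFin, Matrix.mulVec_smul]
      · simp [primalSol_eq_zero_of_notMem _ hi]
  · constructor <;> intros <;> simp [primalSol, h]

/-- The continuous linear map `v ↦ x(I, v)`. -/
noncomputable def primalSolCLM (A : Matrix (Fin m) (Fin d) ℝ) (I : Finset (Fin d)) :
    (Fin m → ℝ) →L[ℝ] (Fin d → ℝ) :=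
  LinearMap.toContinuousLinearMap (isLinearMap_primalSol A I).mk'

@[fun_prop]
theorem continuous_primalSol : Continuous (primalSol A I) := (primalSolCLM A I).continuous

theorem primalSol_sub (v w : Fin m → ℝ) :
    primalSol A I (v - w) = primalSol A I v - primalSol A I w := map_sub (primalSolCLM A I) v w

theorem primalSol_smul (t : ℝ) (v : Fin m → ℝ) : primalSol A I (t • v) = t • primalSol A I v :=
  map_smul (primalSolCLM A I) t v

theorem IsBasis.mulVec_primalSol (hI : IsBasis A I) (v : Fin m → ℝ) :
    A *ᵥ primalSol A I v = v := by
  obtain ⟨h, hu⟩ := hI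
  rw [mulVec_eq_colMat_mulVec h fun i hi => primalSol_eq_zero_of_notMem v hi]
  have : primalSol A I v ∘ I.orderEmbOfFin h = (colMat A I h)⁻¹ *ᵥ v :=
    funext fun k => primalSol_orderEmbOfFin h v k
  rw [this, Matrix.mulVec_mulVec, Matrix.mul_nonsing_inv _ ((Matrix.isUnit_iff_isUnit_det _).1 hu),
    Matrix.one_mulVec]

theorem IsBasis.eq_primalSol (hI : IsBasis A I) {x : Fin d → ℝ} (hx : ∀ i ∉ I, x i = 0) :
    x = primalSol A I (A *ᵥ x) := by
  obtain ⟨h, hu⟩ := hI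
  ext i
  by_cases hi : i ∈ I
  · rw [← Finset.mem_coe, ← Finset.range_orderEmbOfFin I h] at hi
    obtain ⟨k, rfl⟩ := hi
    rw [primalSol_orderEmbOfFin, mulVec_eq_colMat_mulVec h hx, Matrix.mulVec_mulVec,
      Matrix.nonsing_inv_mul _ ((Matrix.isUnit_iff_isUnit_det _).1 hu), Matrix.one_mulVec]
    rfl
  · rw [hx i hi, primalSol_eq_zero_of_notMem _ hi]

theorem IsBasis.bijOn_primalSol (hI : IsBasis A I) :
    Set.BijOn (primalSol A I) Set.univ {x | ∀ i ∉ I, x i = 0} := by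
  refine ⟨fun v _ i hi => primalSol_eq_zero_of_notMem v hi, fun v _ w _ h => ?_, fun x hx =>
    ⟨A *ᵥ x, trivial, (hI.eq_primalSol hx).symm⟩⟩
  rw [← hI.mulVec_primalSol v, ← hI.mulVec_primalSol w, h]

theorem dualSol_of_card (h : I.card = m) :
    dualSol A c I = ((colMat A I h)⁻¹)ᵀ *ᵥ (c ∘ I.orderEmbOfFin h) := by
  simp [dualSol, h]

theorem IsBasis.dualSol_vecMul (hI : IsBasis A I) {i : Fin d} (hi : i ∈ I) :
    (dualSol A c I ᵥ* A) i = c i := by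
  obtain ⟨h, hu⟩ := hI
  rw [← Finset.mem_coe, ← Finset.range_orderEmbOfFin I h] at hi
  obtain ⟨k, rfl⟩ := hi
  have : (dualSol A c I ᵥ* A) (I.orderEmbOfFin h k) = (dualSol A c I ᵥ* colMat A I h) k := rfl
  rw [this, dualSol_of_card h, Matrix.mulVec_transpose, Matrix.vecMul_vecMul,
    Matrix.nonsing_inv_mul _ ((Matrix.isUnit_iff_isUnit_det _).1 hu), Matrix.vecMul_one]
  rfl

theorem IsBasis.eq_dualSol (hI : IsBasis A I) {l : Fin m → ℝ} (hl : ∀ i ∈ I, (l ᵥ* A) i = c i) :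
    l = dualSol A c I := by
  obtain ⟨h, hu⟩ := hI
  have : c ∘ I.orderEmbOfFin h = l ᵥ* colMat A I h :=
    funext fun k => (hl _ (I.orderEmbOfFin_mem h k)).symm
  rw [dualSol_of_card h, this, Matrix.mulVec_transpose, Matrix.vecMul_vecMul,
    Matrix.mul_nonsing_inv _ ((Matrix.isUnit_iff_isUnit_det _).1 hu), Matrix.vecMul_one]

/-- **Weak duality**: a basis that is primal and dual feasible yields an optimal solution. -/
theorem IsDualFeasibleBasis.primalSol_mem_optSet (hI : IsDualFeasibleBasis A c I) {v : Fin m → ℝ}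
    (hv : 0 ≤ primalSol A I v) : primalSol A I v ∈ optSet A c v := by
  refine ⟨⟨hI.1.mulVec_primalSol v, hv⟩, fun y hy => ?_⟩
  have h1 : c ⬝ᵥ primalSol A I v = dualSol A c I ⬝ᵥ v := by
    conv_rhs => rw [← hI.1.mulVec_primalSol v, Matrix.dotProduct_mulVec]
    refine Finset.sum_congr rfl fun i _ => ?_
    by_cases hi : i ∈ I
    · rw [hI.1.dualSol_vecMul hi]
    · rw [primalSol_eq_zero_of_notMem _ hi, mul_zero, mul_zero]
  rw [h1, ← hy.1, Matrix.dotProduct_mulVec]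
  exact dotProduct_le_dotProduct_of_nonneg_right hI.2 hy.2

theorem mem_optBases {b : Fin m → ℝ} :
    I ∈ optBases A c b ↔ IsDualFeasibleBasis A c I ∧ 0 ≤ primalSol A I b := by
  simp [optBases]

/-- Independence together with spanning forces |I| = m, so A_I is square with independent columns.
-/
theorem isBasis_of_linearIndepOn {I : Finset (Fin d)} (hli : LinearIndepOn ℝ A.col ↑I)
    (hspan : Submodule.span ℝ (A.col '' ↑I) = ⊤) : IsBasis A I := by
  have hcard : I.card = m := by
    have h1 := linearIndependent_iff_card_eq_finrank_span.1 hli.linearIndependent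
    have h2 : Set.range (fun i : (↑I : Set (Fin d)) => A.col i) = A.col '' ↑I := by
      ext; simp
    rw [Set.finrank, h2, hspan, finrank_top, Module.finrank_fin_fun] at h1
    simpa using h1
  refine ⟨hcard, Matrix.linearIndependent_cols_iff_isUnit.1 ?_⟩
  exact hli.linearIndependent.comp
    (fun k => (⟨I.orderEmbOfFin hcard k, I.orderEmbOfFin_mem hcard k⟩ : (↑I : Set (Fin d))))
    fun a b hab => (I.orderEmbOfFin hcard).injective (congrArg Subtype.val hab)

/-- **Fundamental theorem of linear programming**: if an optimal solution exists, then some basis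
is primal and dual feasible. -/
theorem optBases_nonempty_of_optSet (hA : A.rank = m) {b : Fin m → ℝ}
    (h : (optSet A c b).Nonempty) : (optBases A c b).Nonempty := by
  classical
  obtain ⟨x, hx⟩ := h
  obtain ⟨l, hl, hcl⟩ := exists_dual_certificate hx
  obtain ⟨⟨hAx, hx0⟩, -⟩ := hx
  -- Complementary slackness: the products of slacks and primal coordinates are nonnegative and have
  -- sum at most 0.
  have htight : ∀ j, x j ≠ 0 → (l ᵥ* A) j = c j := by
    have hnn : ∀ j ∈ Finset.univ, 0 ≤ (c j - (l ᵥ* A) j) * x j := fun j _ =>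
      mul_nonneg (sub_nonneg.2 (hl j)) (hx0 j)
    have hsum : ∑ j, (c j - (l ᵥ* A) j) * x j = 0 := by
      refine le_antisymm ?_ (Finset.sum_nonneg hnn)
      have : l ⬝ᵥ b = (l ᵥ* A) ⬝ᵥ x := by rw [← hAx, Matrix.dotProduct_mulVec]
      rw [this] at hcl
      simp only [sub_mul, Finset.sum_sub_distrib]
      simpa [dotProduct] using hcl
    intro j hj
    have := (Finset.sum_eq_zero_iff_of_nonneg hnn).1 hsum j (Finset.mem_univ j)
    rcases mul_eq_zero.1 this with h | h
    · linarith
    · exact absurd h hj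
  obtain ⟨l', hl', hll', hvert⟩ := exists_dual_vertex hA hl
  obtain ⟨x', hx'0, hx'sum, hx'supp, hli⟩ := exists_nonneg_combination_linearIndepOn A.col hx0
  have hmul : ∀ y : Fin d → ℝ, A *ᵥ y = ∑ j, y j • A.col j := fun y => by
    rw [Matrix.mulVec_eq_sum]
    exact Finset.sum_congr rfl fun j _ => by ext i; simp [Matrix.col, mul_comm]
  have hAx' : A *ᵥ x' = b := by rw [hmul, hx'sum, ← hmul, hAx]
  obtain ⟨I, hIT, hSI, hspan, hIli⟩ := exists_linearIndepOn_extension hli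
    (t := {j | (l' ᵥ* A) j = c j})
    (fun j hj => hll' j (htight j fun h => hj (hx'supp j h)))
  -- A functional vanishing on all tight columns is a direction that the vertex property of `l'`
  -- excludes.
  have htop : Submodule.span ℝ (A.col '' I) = ⊤ := by
    by_contra hne
    obtain ⟨f, hf0, hf⟩ := Submodule.exists_le_ker_of_lt_top _ (lt_top_iff_ne_top.2 hne)
    let u : Fin m → ℝ := fun i => f (Pi.single i 1)
    have hfu : ∀ w, f w = u ⬝ᵥ w := fun w => by
      conv_lhs => rw [pi_eq_sum_univ' w, map_sum]
      simp only [map_smul, smul_eq_mul, dotProduct, u]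
      exact Finset.sum_congr rfl fun i _ => by
        rw [mul_comm]
    have hu : u = 0 := hvert u fun j hj => by
      have : f (A.col j) = 0 := hf (hspan ⟨j, hj, rfl⟩)
      rwa [hfu] at this
    exact hf0 (LinearMap.ext fun w => by rw [hfu, hu]; simp)
  have hI : IsBasis A I.toFinset :=
    isBasis_of_linearIndepOn (by simpa using hIli) (by simpa using htop)
  refine ⟨I.toFinset, mem_optBases.2 ⟨⟨hI, ?_⟩, ?_⟩⟩
  · rw [← hI.eq_dualSol (l := l') fun i hi => hIT (by simpa using hi)]
    exact hl'
  · rw [← hAx', ← hI.eq_primalSol fun i hi => ?_]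
    · exact hx'0
    · by_contra h
      exact hi (by simpa using hSI h)

theorem optSet_nonempty_iff (hA : A.rank = m) {b : Fin m → ℝ} :
    (optSet A c b).Nonempty ↔ (optBases A c b).Nonempty := by
  refine ⟨optBases_nonempty_of_optSet hA, fun ⟨I, hI⟩ => ⟨primalSol A I b, ?_⟩⟩
  obtain ⟨h1, h2⟩ := mem_optBases.1 hI
  exact h1.primalSol_mem_optSet h2

end Basis
end LinProg

namespace LinProg

/-! ### Embedding the random coordinates into ℝ^m -/

section Overwrite

variable {m m₀ : ℕ}

theorem isLinearMap_overwrite_zero :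
    IsLinearMap ℝ (fun v : Fin m₀ → ℝ => (overwrite 0 v : Fin m → ℝ)) := by
  constructor
  · intro v w
    ext i
    by_cases h : (i : ℕ) < m₀ <;> simp [overwrite, h]
  · intro t v
    ext i
    by_cases h : (i : ℕ) < m₀ <;> simp [overwrite, h]

@[fun_prop]
theorem continuous_overwrite (b : Fin m → ℝ) :
    Continuous (fun v : Fin m₀ → ℝ => overwrite b v) := by
  refine continuous_pi fun i => ?_
  by_cases h : (i : ℕ) < m₀
  · simpa [overwrite, h] using continuous_apply _
  · simpa [overwrite, h] using continuous_const

theorem overwrite_sub_self (hm : m₀ ≤ m) (b : Fin m → ℝ) (v : Fin m₀ → ℝ) :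
    overwrite b v - b = overwrite 0 (v - firstCoords hm b) := by
  ext i
  by_cases h : (i : ℕ) < m₀
  · simp [overwrite, h, firstCoords]
  · simp [overwrite, h]

theorem overwrite_firstCoords (hm : m₀ ≤ m) (b : Fin m → ℝ) :
    overwrite b (firstCoords hm b) = b := by
  ext i
  by_cases h : (i : ℕ) < m₀ <;> simp [overwrite, h, firstCoords]

theorem firstCoords_overwrite (hm : m₀ ≤ m) (b : Fin m → ℝ) (v : Fin m₀ → ℝ) :
    firstCoords hm (overwrite b v) = v := by
  ext j
  simp [overwrite, firstCoords]

theorem overwrite_eq_self (b v : Fin m → ℝ) : overwrite b v = v := by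
  ext i
  simp [overwrite]

end Overwrite

/-! ### The cones H_I and stability of the optimal bases near b -/

section Cones

variable {m d m₀ : ℕ} {A : Matrix (Fin m) (Fin d) ℝ} {I : Finset (Fin d)} {b : Fin m → ℝ}
  {c xstar : Fin d → ℝ}

/-- The linear functional `v ↦ x_i(I, (v, 0))`. -/
noncomputable def coneFunctional (m₀ : ℕ) (A : Matrix (Fin m) (Fin d) ℝ) (I : Finset (Fin d))
    (i : Fin d) : (Fin m₀ → ℝ) →ₗ[ℝ] ℝ :=
  LinearMap.proj i ∘ₗ (isLinearMap_primalSol A I).mk' ∘ₗ isLinearMap_overwrite_zero.mk'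

@[simp]
theorem coneFunctional_apply (i : Fin d) (v : Fin m₀ → ℝ) :
    coneFunctional m₀ A I i v = primalSol A I (overwrite 0 v) i := rfl

theorem limitCone_eq_iInter (m₀ : ℕ) (A : Matrix (Fin m) (Fin d) ℝ) (x : Fin d → ℝ)
    (I : Finset (Fin d)) :
    limitCone m₀ A x I = ⋂ i ∈ I \ supp x, {v | 0 ≤ coneFunctional m₀ A I i v} := by
  ext v
  simp [limitCone]

theorem isClosed_limitCone (x : Fin d → ℝ) : IsClosed (limitCone m₀ A x I) := by
  rw [limitCone_eq_iInter]
  exact isClosed_biInter fun i _ =>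
    isClosed_le continuous_const (LinearMap.continuous_of_finiteDimensional _)

theorem convex_limitCone (x : Fin d → ℝ) : Convex ℝ (limitCone m₀ A x I) := by
  rw [limitCone_eq_iInter]
  exact convex_iInter₂ fun i _ => convex_halfSpace_ge (coneFunctional m₀ A I i).isLinear 0

theorem smul_mem_limitCone {x : Fin d → ℝ} {t : ℝ} (ht : 0 ≤ t) {v : Fin m₀ → ℝ}
    (hv : v ∈ limitCone m₀ A x I) : t • v ∈ limitCone m₀ A x I := by
  rw [limitCone_eq_iInter, Set.mem_iInter₂] at *
  intro i hi
  have : 0 ≤ coneFunctional m₀ A I i v := hv i hi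
  change 0 ≤ coneFunctional m₀ A I i (t • v)
  rw [map_smul]
  exact smul_nonneg ht this

theorem smul_mem_limitCone_iff {x : Fin d → ℝ} {t : ℝ} (ht : 0 < t) {v : Fin m₀ → ℝ} :
    t • v ∈ limitCone m₀ A x I ↔ v ∈ limitCone m₀ A x I := by
  refine ⟨fun h => ?_, smul_mem_limitCone ht.le⟩
  have := smul_mem_limitCone (inv_nonneg.2 ht.le) h
  rwa [smul_smul, inv_mul_cancel₀ ht.ne', one_smul] at this

theorem zero_mem_limitCone (x : Fin d → ℝ) : 0 ∈ limitCone m₀ A x I := by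
  rw [limitCone_eq_iInter, Set.mem_iInter₂]
  exact fun i _ => (map_zero (coneFunctional m₀ A I i)).ge

/-- The normals are the rows of A_I⁻¹ indexed by `I \ supp x`, cut to their first `m₀` entries.
Cutting can annihilate a row only if m₀ < m. -/
theorem IsBasis.isInterHalfSpaces_limitCone (hI : IsBasis A I) {x : Fin d → ℝ} (hx : supp x ⊆ I) :
    IsInterHalfSpaces m (m - (supp x).card) (limitCone m₀ A x I) := by
  have hD : (I \ supp x).card = m - (supp x).card := by
    rw [Finset.card_sdiff_of_subset hx, hI.1]
  let e := (I \ supp x).orderEmbOfFin hD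
  have hform : ∀ j (v : Fin m₀ → ℝ),
      (fun k => coneFunctional m₀ A I (e j) (Pi.single k 1)) ⬝ᵥ v = coneFunctional m₀ A I (e j) v :=
    fun j v => by
      conv_rhs => rw [pi_eq_sum_univ' v, map_sum]
      simp only [map_smul, smul_eq_mul, dotProduct]
      exact Finset.sum_congr rfl fun i _ => by rw [mul_comm]
  refine ⟨fun j k => coneFunctional m₀ A I (e j) (Pi.single k 1), ?_, ?_⟩
  · rintro rfl j h
    have hej : e j ∈ I := (Finset.mem_sdiff.1 ((I \ supp x).orderEmbOfFin_mem hD j)).1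
    -- On column `e j` of A the functional takes the value 1, so its normal is not zero.
    have h1 := hform j (A *ᵥ Pi.single (e j) 1)
    beta_reduce at h
    have hsingle : ∀ i ∉ I, (Pi.single (e j) 1 : Fin d → ℝ) i = 0 := fun i hi =>
      Pi.single_eq_of_ne (fun h : i = e j => hi (h ▸ hej)) _
    rw [h, zero_dotProduct, coneFunctional_apply, overwrite_eq_self,
      ← hI.eq_primalSol hsingle] at h1
    simp at h1
  · rw [limitCone_eq_iInter]
    ext v
    simp only [Set.mem_iInter, Set.mem_ofPred_eq, hform]
    constructor
    · exact fun h j => h _ ((I \ supp x).orderEmbOfFin_mem hD j)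
    · intro h i hi
      rw [← Finset.mem_coe, ← Finset.range_orderEmbOfFin _ hD] at hi
      obtain ⟨j, rfl⟩ := hi
      exact h j

theorem primalSol_eq_of_mem_optBases (hA2 : optSet A c b = {xstar}) (hI : I ∈ optBases A c b) :
    primalSol A I b = xstar := by
  obtain ⟨h1, h2⟩ := mem_optBases.1 hI
  have := h1.primalSol_mem_optSet h2
  rwa [hA2] at this

theorem mem_supp {x : Fin d → ℝ} {i : Fin d} : i ∈ supp x ↔ x i ≠ 0 := by simp [supp]

theorem supp_subset_of_primalSol_eq (h : primalSol A I b = xstar) : supp xstar ⊆ I := by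
  intro i hi
  by_contra hiI
  exact mem_supp.1 hi (h ▸ primalSol_eq_zero_of_notMem b hiI)

/-- Near `b` no new optimal bases appear, and the optimal basic solutions stay positive on the
support of the optimal solution for `b`. -/
theorem eventually_optBases_subset (hA2 : optSet A c b = {xstar}) :
    ∀ᶠ w in 𝓝 b, optBases A c w ⊆ optBases A c b ∧
      ∀ I ∈ optBases A c b, ∀ i ∈ supp xstar, 0 < primalSol A I w i := by
  have hx0 : 0 ≤ xstar := by
    have : xstar ∈ optSet A c b := hA2 ▸ rfl
    exact this.1.2
  have h1 : ∀ᶠ w in 𝓝 b, ∀ I : Finset (Fin d), 0 ≤ primalSol A I w → 0 ≤ primalSol A I b := by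
    refine eventually_all.2 fun I => ?_
    by_cases h : 0 ≤ primalSol A I b
    · exact Eventually.of_forall fun _ _ => h
    · have : IsOpen {w | ¬ 0 ≤ primalSol A I w} :=
        (isClosed_le continuous_const continuous_primalSol).isOpen_compl
      filter_upwards [this.mem_nhds h] with w hw h'
      exact absurd h' hw
  have h2 : ∀ᶠ w in 𝓝 b, ∀ I ∈ optBases A c b, ∀ i ∈ supp xstar, 0 < primalSol A I w i := by
    rw [Filter.eventually_all_finset]
    intro I hI
    rw [Filter.eventually_all_finset]
    intro i hi
    have hopen : IsOpen {w | 0 < primalSol A I w i} :=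
      isOpen_lt continuous_const ((continuous_apply i).comp continuous_primalSol)
    refine hopen.mem_nhds ?_
    change 0 < primalSol A I b i
    rw [primalSol_eq_of_mem_optBases hA2 hI]
    exact lt_of_le_of_ne (hx0 i) (mem_supp.1 hi).symm
  filter_upwards [h1, h2] with w hw1 hw2
  exact ⟨fun I hI => mem_optBases.2 ⟨(mem_optBases.1 hI).1, hw1 I (mem_optBases.1 hI).2⟩, hw2⟩

/-- Off its support x⋆ = x(I, b) vanishes, so by linearity the coordinates of x(I, ·) there depend
only on the increment from `b`; on the support `hpos` settles the sign. -/
theorem mem_optBases_overwrite_iff (hm : m₀ ≤ m) (hA2 : optSet A c b = {xstar})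
    (hI : I ∈ optBases A c b) {v : Fin m₀ → ℝ}
    (hpos : ∀ i ∈ supp xstar, 0 < primalSol A I (overwrite b v) i) :
    I ∈ optBases A c (overwrite b v) ↔ v - firstCoords hm b ∈ limitCone m₀ A xstar I := by
  have hIb := primalSol_eq_of_mem_optBases hA2 hI
  have hcoord : ∀ i ∉ supp xstar, primalSol A I (overwrite 0 (v - firstCoords hm b)) i =
      primalSol A I (overwrite b v) i := fun i hi => by
    rw [← overwrite_sub_self hm, primalSol_sub, hIb, Pi.sub_apply,
      not_ne_iff.1 (mem_supp.not.1 hi), sub_zero]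
  rw [mem_optBases]
  constructor
  · rintro ⟨-, h⟩ i hi
    rw [hcoord i (Finset.mem_sdiff.1 hi).2]
    exact h i
  · refine fun h => ⟨(mem_optBases.1 hI).1, fun i => ?_⟩
    by_cases hi : i ∈ supp xstar
    · exact (hpos i hi).le
    by_cases hiI : i ∈ I
    · have := h i (Finset.mem_sdiff.2 ⟨hiI, hi⟩)
      rwa [hcoord i hi] at this
    · exact (primalSol_eq_zero_of_notMem _ hiI).ge

end Cones

/-! ### The cells: a partition with null boundaries -/

section Cells

variable {m d m₀ : ℕ} {A : Matrix (Fin m) (Fin d) ℝ} {x : Fin d → ℝ}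
  {ℬ 𝒦 ℒ : Finset (Finset (Fin d))} {g : Fin m₀ → ℝ}

theorem mem_limitCell :
    g ∈ limitCell m₀ A x ℬ 𝒦 ↔
      (∀ I ∈ 𝒦, g ∈ limitCone m₀ A x I) ∧ ∀ I ∈ ℬ, I ∉ 𝒦 → g ∉ limitCone m₀ A x I := by
  simp only [limitCell, Set.mem_sdiff, Set.mem_iInter, Set.mem_iUnion, Finset.mem_sdiff, not_exists,
    and_imp]

theorem eq_of_mem_limitCell (h𝒦 : 𝒦 ⊆ ℬ) (hℒ : ℒ ⊆ ℬ) (h1 : g ∈ limitCell m₀ A x ℬ 𝒦)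
    (h2 : g ∈ limitCell m₀ A x ℬ ℒ) : 𝒦 = ℒ := by
  rw [mem_limitCell] at h1 h2
  ext I
  constructor
  · intro h
    by_contra h'
    exact h2.2 I (h𝒦 h) h' (h1.1 I h)
  · intro h
    by_contra h'
    exact h1.2 I (hℒ h) h' (h2.1 I h)

theorem exists_mem_limitCell (A : Matrix (Fin m) (Fin d) ℝ) (x : Fin d → ℝ)
    (ℬ : Finset (Finset (Fin d))) (g : Fin m₀ → ℝ) : ∃ 𝒦 ⊆ ℬ, g ∈ limitCell m₀ A x ℬ 𝒦 := by
  classical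
  refine ⟨ℬ.filter fun I => g ∈ limitCone m₀ A x I, Finset.filter_subset _ _, ?_⟩
  rw [mem_limitCell]
  exact ⟨fun I hI => (Finset.mem_filter.1 hI).2,
    fun I hI hn h => hn (Finset.mem_filter.2 ⟨hI, h⟩)⟩

/-- Cells of distinct subsets of ℬ are disjoint, so no other summand survives. The cell of ∅ carries
no summand, and there both sides are 0. -/
theorem limitM_of_mem_limitCell (α : (𝒦 : Finset (Finset (Fin d))) → 𝒦 → ℝ) (h𝒦 : 𝒦 ⊆ ℬ)
    (hg : g ∈ limitCell m₀ A x ℬ 𝒦) :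
    limitM A x ℬ α g = weightedSol A 𝒦 (α 𝒦) (overwrite 0 g) := by
  classical
  have hne : ∀ ℒ ∈ ℬ.powerset.filter (fun 𝒦 => 𝒦.Nonempty), ℒ ≠ 𝒦 →
      (limitCell m₀ A x ℬ ℒ).indicator (fun g => weightedSol A ℒ (α ℒ) (overwrite 0 g)) g = 0 := by
    intro ℒ hℒ hne
    refine Set.indicator_of_notMem (fun h => hne ?_) _
    exact eq_of_mem_limitCell (Finset.mem_powerset.1 (Finset.mem_filter.1 hℒ).1) h𝒦 h hg
  rw [limitM]
  rcases 𝒦.eq_empty_or_nonempty with rfl | hnonempty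
  · rw [Finset.sum_eq_zero fun ℒ hℒ => hne ℒ hℒ (Finset.mem_filter.1 hℒ).2.ne_empty]
    simp [weightedSol]
  · rw [Finset.sum_eq_single_of_mem 𝒦
      (Finset.mem_filter.2 ⟨Finset.mem_powerset.2 h𝒦, hnonempty⟩) hne, Set.indicator_of_mem hg]

theorem measurableSet_limitCell : MeasurableSet (limitCell m₀ A x ℬ 𝒦) :=
  (Finset.measurableSet_biInter _ fun _ _ => (isClosed_limitCone x).measurableSet).diff
    (Finset.measurableSet_biUnion _ fun _ _ => (isClosed_limitCone x).measurableSet)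

/-- Away from the boundaries of the cones, membership in every cone is locally constant, hence so is
membership in the cell. -/
theorem frontier_limitCell_subset (h𝒦 : 𝒦 ⊆ ℬ) :
    frontier (limitCell m₀ A x ℬ 𝒦) ⊆ ⋃ I ∈ ℬ, frontier (limitCone m₀ A x I) := by
  intro g hg
  by_contra hn
  simp only [Set.mem_iUnion, not_exists] at hn
  have hloc : ∀ᶠ y in 𝓝 g, ∀ I ∈ ℬ, (y ∈ limitCone m₀ A x I ↔ g ∈ limitCone m₀ A x I) := by
    rw [Filter.eventually_all_finset]
    intro I hI
    by_cases h : g ∈ limitCone m₀ A x I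
    · have : g ∈ interior (limitCone m₀ A x I) := by
        by_contra h'
        exact hn I hI ⟨subset_closure h, h'⟩
      filter_upwards [mem_interior_iff_mem_nhds.1 this] with y hy
      simp [h, hy]
    · filter_upwards [(isClosed_limitCone x).isOpen_compl.mem_nhds h] with y hy
      simpa [h] using hy
  have hcell : ∀ᶠ y in 𝓝 g, (y ∈ limitCell m₀ A x ℬ 𝒦 ↔ g ∈ limitCell m₀ A x ℬ 𝒦) := by
    filter_upwards [hloc] with y hy
    rw [mem_limitCell, mem_limitCell]
    refine and_congr (forall₂_congr fun I hI => hy I (h𝒦 hI)) (forall₂_congr fun I hI => ?_)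
    rw [hy I hI]
  by_cases h : g ∈ limitCell m₀ A x ℬ 𝒦
  · exact hg.2 (mem_interior_iff_mem_nhds.2 (by filter_upwards [hcell] with y hy using hy.2 h))
  · obtain ⟨y, hy1, hy2⟩ := ((mem_closure_iff_frequently.1 hg.1).and_eventually hcell).exists
    exact h (hy2.1 hy1)

/-- Convex sets have Lebesgue-null boundary, so degenerate cones (empty interior, or the full space)
need no separate treatment. -/
theorem volume_frontier_limitCell (h𝒦 : 𝒦 ⊆ ℬ) :
    volume (frontier (limitCell m₀ A x ℬ 𝒦)) = 0 := by
  refine measure_mono_null (frontier_limitCell_subset h𝒦) ?_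
  refine (measure_biUnion_null_iff ℬ.countable_toSet).2 ?_
  exact fun I _ => (convex_limitCone x).addHaar_frontier volume

end Cells

end LinProg

namespace LinProg

/-! ### Tools for convergence in distribution -/

section Distribution

variable {Ω Ω' : Type*} [MeasurableSpace Ω] [MeasurableSpace Ω'] {P : Measure Ω}
  [IsProbabilityMeasure P] {P' : Measure Ω'} [IsProbabilityMeasure P']

theorem limsup_measure_preimage_le {E : Type*} [TopologicalSpace E] [MeasurableSpace E]
    [OpensMeasurableSpace E] [HasOuterApproxClosed E] {X : ℕ → Ω → E} {X' : Ω' → E}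
    (h : TendstoInDistribution X atTop X' (fun _ => P) P') {F : Set E} (hF : IsClosed F) :
    limsup (fun n => P (X n ⁻¹' F)) atTop ≤ P' (X' ⁻¹' F) := by
  have := ProbabilityMeasure.limsup_measure_closed_le_of_tendsto h.tendsto hF
  simp only [ProbabilityMeasure.coe_mk,
    Measure.map_apply_of_aemeasurable (h.forall_aemeasurable _) hF.measurableSet,
    Measure.map_apply_of_aemeasurable h.aemeasurable_limit hF.measurableSet] at this
  exact this

theorem tendstoInDistribution_of_limsup_le {E : Type*} [TopologicalSpace E] [MeasurableSpace E]
    [OpensMeasurableSpace E] {X : ℕ → Ω → E} {X' : Ω' → E} (hX : ∀ n, AEMeasurable (X n) P)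
    (hX' : AEMeasurable X' P')
    (h : ∀ F, IsClosed F → limsup (fun n => P (X n ⁻¹' F)) atTop ≤ P' (X' ⁻¹' F)) :
    TendstoInDistribution X atTop X' (fun _ => P) P' where
  forall_aemeasurable := hX
  aemeasurable_limit := hX'
  tendsto := by
    refine tendsto_of_forall_isClosed_limsup_le' fun F hF => ?_
    simp only [ProbabilityMeasure.coe_mk,
      Measure.map_apply_of_aemeasurable (hX _) hF.measurableSet,
      Measure.map_apply_of_aemeasurable hX' hF.measurableSet]
    exact h F hF

/-- Convergence in distribution of a random variable that is pieced together from finitely many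
continuous images of converging random variables: `Z n = φ k (X k n)` on the event
`X k n ∈ C k`, where the boundary of `C k` is not charged in the limit. -/
theorem tendstoInDistribution_of_pieces {κ : Type*} (S : Finset κ) {E : κ → Type*}
    [∀ k, TopologicalSpace (E k)] [∀ k, MeasurableSpace (E k)] [∀ k, OpensMeasurableSpace (E k)]
    [∀ k, HasOuterApproxClosed (E k)] {F : Type*} [TopologicalSpace F] [MeasurableSpace F]
    [OpensMeasurableSpace F]
    {X : ∀ k, ℕ → Ω → E k} {X' : ∀ k, Ω' → E k}
    (hX : ∀ k ∈ S, TendstoInDistribution (X k) atTop (X' k) (fun _ => P) P')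
    {C : ∀ k, Set (E k)} (hC : ∀ k ∈ S, P' (X' k ⁻¹' frontier (C k)) = 0)
    {φ : ∀ k, E k → F} (hφ : ∀ k ∈ S, Continuous (φ k))
    {Z : ℕ → Ω → F} {Z' : Ω' → F} (hZm : ∀ n, AEMeasurable (Z n) P) (hZ'm : AEMeasurable Z' P')
    (hZ : ∀ n ω, ∃ k ∈ S, X k n ω ∈ C k ∧ Z n ω = φ k (X k n ω))
    (hZ' : ∀ ω', ∀ k ∈ S, X' k ω' ∈ C k → Z' ω' = φ k (X' k ω'))
    (hdisj : ∀ ω', ∀ k ∈ S, ∀ l ∈ S, X' k ω' ∈ C k → X' l ω' ∈ C l → k = l) :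
    TendstoInDistribution Z atTop Z' (fun _ => P) P' := by
  refine tendstoInDistribution_of_limsup_le hZm hZ'm fun K hK => ?_
  -- Closing up `C k` makes portmanteau applicable; in the limit this adds only boundary points, a
  -- null event.
  let D : ∀ k, Set (E k) := fun k => closure (C k) ∩ φ k ⁻¹' K
  have hD : ∀ k ∈ S, IsClosed (D k) := fun k hk => isClosed_closure.inter (hK.preimage (hφ k hk))
  have hDC : ∀ k, ∀ y ∈ D k, y ∉ frontier (C k) → y ∈ C k := fun k y hy hyf => by
    by_contra h
    exact hyf ⟨hy.1, fun h' => h (interior_subset h')⟩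
  have hnull : ∀ k ∈ S, ∀ᵐ ω' ∂P', X' k ω' ∉ frontier (C k) := fun k hk =>
    measure_eq_zero_iff_ae_notMem.1 (hC k hk)
  have hsum : ∑ k ∈ S, P' (X' k ⁻¹' D k) ≤ P' (Z' ⁻¹' K) := by
    rw [← measure_biUnion_finset₀]
    · refine measure_mono_ae ?_
      have : ∀ᵐ ω' ∂P', ∀ k ∈ S, X' k ω' ∉ frontier (C k) :=
        (ae_ball_iff S.countable_toSet).2 hnull
      filter_upwards [this] with ω' hω' hmem
      obtain ⟨k, hk, hkD⟩ := Set.mem_iUnion₂.1 hmem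
      change Z' ω' ∈ K
      rw [hZ' ω' k hk (hDC k _ hkD (hω' k hk))]
      exact hkD.2
    · intro k hk l hl hkl
      refine measure_eq_zero_iff_ae_notMem.2 ?_
      filter_upwards [hnull k hk, hnull l hl] with ω' h1 h2 hmem
      exact hkl (hdisj ω' k hk l hl (hDC k _ hmem.1 h1) (hDC l _ hmem.2 h2))
    · exact fun k hk => (hX k hk).aemeasurable_limit.nullMeasurableSet_preimage
        (hD k hk).measurableSet
  refine le_trans ?_ hsum
  refine ENNReal.le_of_forall_pos_le_add fun ε hε _ => ?_
  -- The `+ 1` keeps the denominator nonzero when `S` is empty.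
  have hev : ∀ᶠ n in atTop, ∀ k ∈ S,
      P (X k n ⁻¹' D k) ≤ P' (X' k ⁻¹' D k) + ε / (S.card + 1 : ℝ≥0∞) := by
    rw [Filter.eventually_all_finset]
    intro k hk
    have hlt : limsup (fun n => P (X k n ⁻¹' D k)) atTop <
        P' (X' k ⁻¹' D k) + ε / (S.card + 1 : ℝ≥0∞) :=
      (limsup_measure_preimage_le (hX k hk) (hD k hk)).trans_lt
        (ENNReal.lt_add_right (measure_ne_top _ _)
          (ENNReal.div_pos (by exact_mod_cast hε.ne') (by simp)).ne')
    filter_upwards [eventually_lt_of_limsup_lt hlt] with n hn using hn.le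
  refine limsup_le_of_le (by isBoundedDefault) ?_
  filter_upwards [hev] with n hn
  calc P (Z n ⁻¹' K) ≤ P (⋃ k ∈ S, X k n ⁻¹' D k) := by
        refine measure_mono fun ω hω => ?_
        obtain ⟨k, hk, h1, h2⟩ := hZ n ω
        exact Set.mem_iUnion₂.2 ⟨k, hk, subset_closure h1, by
          change φ k (X k n ω) ∈ K
          rw [← h2]; exact hω⟩
    _ ≤ ∑ k ∈ S, P (X k n ⁻¹' D k) := measure_biUnion_finset_le _ _
    _ ≤ ∑ k ∈ S, (P' (X' k ⁻¹' D k) + ε / (S.card + 1 : ℝ≥0∞)) := Finset.sum_le_sum hn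
    _ = ∑ k ∈ S, P' (X' k ⁻¹' D k) + S.card * (ε / (S.card + 1 : ℝ≥0∞)) := by
        rw [Finset.sum_add_distrib, Finset.sum_const, nsmul_eq_mul]
    _ ≤ ∑ k ∈ S, P' (X' k ⁻¹' D k) + ε := by
        gcongr
        calc (S.card : ℝ≥0∞) * (ε / (S.card + 1 : ℝ≥0∞))
            ≤ (S.card + 1) * (ε / (S.card + 1 : ℝ≥0∞)) := by gcongr; exact le_self_add
          _ = ε := ENNReal.mul_div_cancel (by simp) (by simp)

/-- Changing random variables on events of vanishing probability does not affect convergence in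
distribution. -/
theorem tendstoInDistribution_of_eq_off {E : Type*} [NormedAddCommGroup E] [MeasurableSpace E]
    [BorelSpace E] [SecondCountableTopology E] {Y Z : ℕ → Ω → E} {Z' : Ω' → E}
    (hZ : TendstoInDistribution Z atTop Z' (fun _ => P) P') (hY : ∀ n, AEMeasurable (Y n) P)
    {D : ℕ → Set Ω} (hD : Tendsto (fun n => P (D n)) atTop (𝓝 0))
    (hYZ : ∀ᶠ n in atTop, ∀ ω ∉ D n, Y n ω = Z n ω) :
    TendstoInDistribution Y atTop Z' (fun _ => P) P' := by
  refine tendstoInDistribution_of_tendstoInMeasure_sub Y Z' hZ ?_ hY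
  rw [tendstoInMeasure_iff_norm]
  intro ε hε
  refine tendsto_of_tendsto_of_tendsto_of_le_of_le' tendsto_const_nhds hD
    (Eventually.of_forall fun _ => zero_le) ?_
  filter_upwards [hYZ] with n hn
  refine measure_mono fun ω hω => ?_
  by_contra h
  have : ε ≤ ‖(Y - Z) n ω - (0 : Ω → E) ω‖ := hω
  simp [hn ω h] at this
  linarith

/-- If the rescaled deviations `r n • (v n - a)` converge in distribution and `r n → ∞`, then
`v n → a` in probability. -/
theorem tendsto_measure_notMem_of_rescaled {E : Type*} [NormedAddCommGroup E] [NormedSpace ℝ E]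
    [MeasurableSpace E] [BorelSpace E] [SecondCountableTopology E] {r : ℕ → ℝ}
    (hr : Tendsto r atTop atTop) {v : ℕ → Ω → E} {a : E} {G : Ω' → E}
    (h : TendstoInDistribution (fun n ω => r n • (v n ω - a)) atTop G (fun _ => P) P')
    {U : Set E} (hU : U ∈ 𝓝 a) : Tendsto (fun n => P {ω | v n ω ∉ U}) atTop (𝓝 0) := by
  -- Slutsky: multiplying the rescaled deviation by 1 / r_n → 0 gives convergence in distribution to
  -- the constant 0.
  have hmeas : TendstoInMeasure P (fun n (_ : Ω) => (r n)⁻¹) atTop (fun _ => (0 : ℝ)) := by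
    rw [tendstoInMeasure_iff_norm]
    intro ε hε
    refine tendsto_const_nhds.congr' ?_
    have := (tendsto_inv_atTop_zero.comp hr).norm.eventually_lt_const
      (show ‖(0 : ℝ)‖ < ε by simpa using hε)
    filter_upwards [this] with n hn
    have : ¬ ε ≤ ‖(r n)⁻¹ - 0‖ := by simpa using hn
    simp only [this]
    simp
  have hconv := h.continuous_comp_prodMk_of_tendstoInMeasure_const
    (g := fun p : E × ℝ => p.2 • p.1) (by fun_prop) hmeas (fun _ => aemeasurable_const)
  obtain ⟨V, hVU, hVo, haV⟩ := mem_nhds_iff.1 hU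
  have hF : IsClosed {y : E | y + a ∉ V} :=
    (hVo.preimage (continuous_id.add continuous_const)).isClosed_compl
  have hlim := limsup_measure_preimage_le hconv hF
  have h0 : P' ((fun ω => (0 : ℝ) • G ω) ⁻¹' {y : E | y + a ∉ V}) = 0 := by
    simp [haV]
  rw [h0] at hlim
  have hlim' : Tendsto (fun n => P ((fun ω => (r n)⁻¹ • (r n • (v n ω - a))) ⁻¹'
      {y : E | y + a ∉ V})) atTop (𝓝 0) :=
    tendsto_of_le_liminf_of_limsup_le zero_le hlim
  refine tendsto_of_tendsto_of_tendsto_of_le_of_le' tendsto_const_nhds hlim'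
    (Eventually.of_forall fun _ => zero_le) ?_
  filter_upwards [hr.eventually_gt_atTop 0] with n hn
  refine measure_mono fun ω hω => ?_
  have h1 : v n ω ∉ U := hω
  change (r n)⁻¹ • (r n • (v n ω - a)) + a ∉ V
  rw [smul_smul, inv_mul_cancel₀ hn.ne', one_smul, sub_add_cancel]
  exact fun h => h1 (hVU h)

end Distribution
end LinProg

namespace LinProg

/-! ### Convergence of the weighted sums M -/

section Weights

variable {m d m₀ : ℕ} {A : Matrix (Fin m) (Fin d) ℝ} {x : Fin d → ℝ}
  {ℬ 𝒦 : Finset (Finset (Fin d))}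

@[fun_prop]
theorem continuous_weightedSol :
    Continuous fun p : (𝒦 → ℝ) × (Fin m₀ → ℝ) => weightedSol A 𝒦 p.1 (overwrite 0 p.2) := by
  unfold weightedSol
  refine continuous_finsetSum _ fun I _ => ?_
  exact ((continuous_apply I).comp continuous_fst).smul
    (continuous_primalSol.comp ((continuous_overwrite 0).comp continuous_snd))

theorem aemeasurable_limitM {Ω : Type*} [MeasurableSpace Ω] {P : Measure Ω}
    {α : (𝒦 : Finset (Finset (Fin d))) → Ω → 𝒦 → ℝ} {g : Ω → Fin m₀ → ℝ}
    (h : ∀ 𝒦 ⊆ ℬ, AEMeasurable (fun ω => (α 𝒦 ω, g ω)) P) :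
    AEMeasurable (fun ω => limitM A x ℬ (fun 𝒦 => α 𝒦 ω) (g ω)) P := by
  unfold limitM
  refine Finset.aemeasurable_fun_sum _ fun 𝒦 h𝒦 => ?_
  have hmeas : Measurable fun p : (𝒦 → ℝ) × (Fin m₀ → ℝ) =>
      (Prod.snd ⁻¹' limitCell m₀ A x ℬ 𝒦).indicator
        (fun p : (𝒦 → ℝ) × (Fin m₀ → ℝ) => weightedSol A 𝒦 p.1 (overwrite 0 p.2)) p :=
    continuous_weightedSol.measurable.indicator (measurable_snd measurableSet_limitCell)
  exact hmeas.comp_aemeasurable (h 𝒦 (Finset.mem_powerset.1 (Finset.mem_filter.1 h𝒦).1))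

/-- Convergence in distribution of the weighted sums `M` under joint convergence of the weights and
the deviations. -/
theorem tendstoInDistribution_limitM {Ω Ω' : Type*} [MeasurableSpace Ω] [MeasurableSpace Ω']
    {P : Measure Ω} [IsProbabilityMeasure P] {P' : Measure Ω'} [IsProbabilityMeasure P']
    {g : ℕ → Ω → Fin m₀ → ℝ} {G : Ω' → Fin m₀ → ℝ} (hG : P'.map G ≪ volume)
    {αn : (𝒦 : Finset (Finset (Fin d))) → ℕ → Ω → 𝒦 → ℝ}
    {α : (𝒦 : Finset (Finset (Fin d))) → Ω' → 𝒦 → ℝ}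
    (h : ∀ 𝒦 ⊆ ℬ, TendstoInDistribution (fun n ω => (αn 𝒦 n ω, g n ω)) atTop
      (fun ω' => (α 𝒦 ω', G ω')) (fun _ => P) P') :
    TendstoInDistribution (fun n ω => limitM A x ℬ (fun 𝒦 => αn 𝒦 n ω) (g n ω)) atTop
      (fun ω' => limitM A x ℬ (fun 𝒦 => α 𝒦 ω') (G ω')) (fun _ => P) P' := by
  -- The empty set is included among the pieces so that the cells cover the whole space.
  refine tendstoInDistribution_of_pieces ℬ.powerset (E := fun 𝒦 => (𝒦 → ℝ) × (Fin m₀ → ℝ))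
    (X := fun 𝒦 n ω => (αn 𝒦 n ω, g n ω)) (X' := fun 𝒦 ω' => (α 𝒦 ω', G ω'))
    (C := fun 𝒦 => Prod.snd ⁻¹' limitCell m₀ A x ℬ 𝒦)
    (φ := fun 𝒦 p => weightedSol A 𝒦 p.1 (overwrite 0 p.2))
    (fun 𝒦 h𝒦 => h 𝒦 (Finset.mem_powerset.1 h𝒦)) (fun 𝒦 h𝒦 => ?_)
    (fun _ _ => continuous_weightedSol)
    (fun n => aemeasurable_limitM fun 𝒦 h𝒦 => (h 𝒦 h𝒦).forall_aemeasurable n)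
    (aemeasurable_limitM fun 𝒦 h𝒦 => (h 𝒦 h𝒦).aemeasurable_limit)
    (fun n ω => ?_) (fun ω' 𝒦 h𝒦 hmem => ?_) (fun ω' 𝒦 h𝒦 ℒ hℒ h1 h2 => ?_)
  · have hGm : AEMeasurable G P' :=
      measurable_snd.comp_aemeasurable (h ∅ (Finset.empty_subset _)).aemeasurable_limit
    have h0 := hG (volume_frontier_limitCell (A := A) (x := x) (Finset.mem_powerset.1 h𝒦))
    rw [Measure.map_apply_of_aemeasurable hGm isClosed_frontier.measurableSet] at h0
    exact measure_mono_null
      (Set.preimage_mono (continuous_snd.frontier_preimage_subset _)) h0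
  · obtain ⟨𝒦, h𝒦, hmem⟩ := exists_mem_limitCell A x ℬ (g n ω)
    exact ⟨𝒦, Finset.mem_powerset.2 h𝒦, hmem, limitM_of_mem_limitCell _ h𝒦 hmem⟩
  · exact limitM_of_mem_limitCell _ (Finset.mem_powerset.1 h𝒦) hmem
  · exact eq_of_mem_limitCell (Finset.mem_powerset.1 h𝒦) (Finset.mem_powerset.1 hℒ) h1 h2

end Weights

/-! ### From perturbed solutions to the limit formula -/

section Solutions

variable {m d m₀ : ℕ} {A : Matrix (Fin m) (Fin d) ℝ} {b : Fin m → ℝ} {c xstar : Fin d → ℝ}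
  {I : Finset (Fin d)}

/-- The set of right-hand sides with an optimal solution is closed. -/
theorem isClosed_optSet_nonempty (hA : A.rank = m) :
    IsClosed {w : Fin m → ℝ | (optSet A c w).Nonempty} := by
  have : {w : Fin m → ℝ | (optSet A c w).Nonempty} =
      ⋃ I : {I : Finset (Fin d) // IsDualFeasibleBasis A c I}, {w | 0 ≤ primalSol A I w} := by
    ext w
    rw [Set.mem_ofPred_eq, optSet_nonempty_iff hA]
    simp [Finset.Nonempty, mem_optBases]
  rw [this]
  exact isClosed_iUnion_of_finite fun I => isClosed_le continuous_const continuous_primalSol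

/-- On the event that the weights represent the solution, the rescaled deviation is given by the
formula for the limit. -/
theorem smul_sub_eq_limitM (hm : m₀ ≤ m) (hA2 : optSet A c b = {xstar}) {v : Fin m₀ → ℝ}
    (hsub : optBases A c (overwrite b v) ⊆ optBases A c b)
    (hpos : ∀ I ∈ optBases A c b, ∀ i ∈ supp xstar, 0 < primalSol A I (overwrite b v) i)
    {α : (𝒦 : Finset (Finset (Fin d))) → 𝒦 → ℝ}
    (hα : α (optBases A c (overwrite b v)) ∈ stdSimplex ℝ _) {x : Fin d → ℝ}
    (hx : x = weightedSol A _ (α (optBases A c (overwrite b v))) (overwrite b v))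
    {r : ℝ} (hr : 0 < r) :
    r • (x - xstar) = limitM A xstar (optBases A c b) α (r • (v - firstCoords hm b)) := by
  have hcell : r • (v - firstCoords hm b) ∈
      limitCell m₀ A xstar (optBases A c b) (optBases A c (overwrite b v)) := by
    rw [mem_limitCell]
    refine ⟨fun I hI => ?_, fun I hI hn => ?_⟩
    · rw [smul_mem_limitCone_iff hr]
      exact (mem_optBases_overwrite_iff hm hA2 (hsub hI) (hpos I (hsub hI))).1 hI
    · rw [smul_mem_limitCone_iff hr]
      exact fun h => hn ((mem_optBases_overwrite_iff hm hA2 hI (hpos I hI)).2 h)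
  rw [limitM_of_mem_limitCell α hsub hcell, hx]
  generalize hℒ : optBases A c (overwrite b v) = ℒ at *
  -- Since the weights sum to one, x⋆ can be subtracted basis by basis as x(I, b).
  have hstar : xstar = ∑ I : ℒ, α ℒ I • xstar := by
    rw [← Finset.sum_smul, hα.2, one_smul]
  conv_lhs => rw [hstar]
  rw [weightedSol, weightedSol, ← Finset.sum_sub_distrib, Finset.smul_sum]
  refine Finset.sum_congr rfl fun I _ => ?_
  rw [isLinearMap_overwrite_zero.map_smul, primalSol_smul, ← overwrite_sub_self hm, primalSol_sub,
    primalSol_eq_of_mem_optBases hA2 (hsub I.2), ← smul_sub, smul_comm]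

/-- If the unique optimal solution for `b` is positive on the basis `I`, then uniqueness persists
for every right-hand side for which `I` is feasible. -/
theorem eq_primalSol_of_mem_optSet (hA2 : optSet A c b = {xstar}) (hI : I ∈ optBases A c b)
    (hIs : I ⊆ supp xstar) {w : Fin m → ℝ} (hw : 0 ≤ primalSol A I w) {y : Fin d → ℝ}
    (hy : y ∈ optSet A c w) : y = primalSol A I w := by
  have hdf := (mem_optBases.1 hI).1
  have hxw := hdf.primalSol_mem_optSet hw
  have hstar : xstar ∈ optSet A c b := hA2 ▸ rfl
  -- A second optimum at `w` gives a cost-neutral direction in the kernel of A. It is nonnegative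
  -- off `I`, where x⋆ may vanish, so a small step from x⋆ yields a second optimum at `b`.
  set z := y - primalSol A I w with hz
  have hAz : A *ᵥ z = 0 := by rw [hz, Matrix.mulVec_sub, hy.1.1, hxw.1.1, sub_self]
  have hcz : c ⬝ᵥ z = 0 := by
    rw [hz, dotProduct_sub, le_antisymm (hy.2 _ hxw.1) (hxw.2 _ hy.1), sub_self]
  have hev : ∀ᶠ ε in 𝓝[>] (0 : ℝ), ∀ i, 0 ≤ xstar i + ε * z i := by
    refine eventually_all.2 fun i => ?_
    by_cases hi : i ∈ I
    · have hpos : 0 < xstar i := lt_of_le_of_ne (hstar.1.2 i) (mem_supp.1 (hIs hi)).symm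
      have hc : Tendsto (fun ε : ℝ => xstar i + ε * z i) (𝓝[>] 0) (𝓝 (xstar i + 0 * z i)) :=
        Tendsto.mono_left (Continuous.tendsto (by fun_prop) 0) nhdsWithin_le_nhds
      filter_upwards [hc.eventually_const_lt (by simpa using hpos)] with ε hε using hε.le
    · filter_upwards [self_mem_nhdsWithin] with ε hε
      have hzi : 0 ≤ z i := by
        rw [hz, Pi.sub_apply, primalSol_eq_zero_of_notMem _ hi, sub_zero]
        exact hy.1.2 i
      exact add_nonneg (hstar.1.2 i) (mul_nonneg (le_of_lt hε) hzi)
  obtain ⟨ε, hε, hε0⟩ := (hev.and self_mem_nhdsWithin).exists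
  have hεpos : (0 : ℝ) < ε := hε0
  have hmem : xstar + ε • z ∈ optSet A c b := by
    refine ⟨⟨?_, fun i => hε i⟩, fun u hu => ?_⟩
    · rw [Matrix.mulVec_add, Matrix.mulVec_smul, hAz, smul_zero, add_zero, hstar.1.1]
    · rw [dotProduct_add, dotProduct_smul, hcz, smul_zero, add_zero]
      exact hstar.2 u hu
  rw [hA2, Set.mem_singleton_iff, add_eq_left] at hmem
  exact sub_eq_zero.1 ((smul_eq_zero.1 hmem).resolve_left hεpos.ne.symm)

/-- The exceptional events, on which the perturbed program has no optimal solution or `b_n` is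
not near `b`, have vanishing probability. -/
theorem tendsto_measure_exceptional (hm : m₀ ≤ m) (hA : A.rank = m) {Ω Ω' : Type*}
    [MeasurableSpace Ω] [MeasurableSpace Ω'] {P : Measure Ω} [IsProbabilityMeasure P]
    {P' : Measure Ω'} [IsProbabilityMeasure P'] {r : ℕ → ℝ} (hr : Tendsto r atTop atTop)
    {v : ℕ → Ω → Fin m₀ → ℝ} (hv : ∀ n, Measurable (v n)) {G : Ω' → Fin m₀ → ℝ}
    (hconv : TendstoInDistribution (fun n ω => r n • (v n ω - firstCoords hm b)) atTop G
      (fun _ => P) P')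
    (hopt : Tendsto (fun n => P {ω | (optSet A c (overwrite b (v n ω))).Nonempty}) atTop (𝓝 1))
    {U : Set (Fin m → ℝ)} (hU : U ∈ 𝓝 b) :
    Tendsto (fun n => P ({ω | (optSet A c (overwrite b (v n ω))).Nonempty}ᶜ ∪
      {ω | overwrite b (v n ω) ∉ U})) atTop (𝓝 0) := by
  have h1 : Tendsto (fun n => P {ω | (optSet A c (overwrite b (v n ω))).Nonempty}ᶜ) atTop
      (𝓝 0) := by
    have hmeas : ∀ n, MeasurableSet {ω | (optSet A c (overwrite b (v n ω))).Nonempty} := fun n =>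
      ((continuous_overwrite b).measurable.comp (hv n)) (isClosed_optSet_nonempty hA).measurableSet
    simp only [prob_compl_eq_one_sub (hmeas _)]
    simpa using ENNReal.Tendsto.sub tendsto_const_nhds hopt (Or.inl ENNReal.one_ne_top)
  have hU' : (fun v : Fin m₀ → ℝ => overwrite b v) ⁻¹' U ∈ 𝓝 (firstCoords hm b) :=
    (continuous_overwrite b).continuousAt.preimage_mem_nhds
      (by rwa [overwrite_firstCoords])
  have h2 := tendsto_measure_notMem_of_rescaled hr hconv hU'
  refine tendsto_of_tendsto_of_tendsto_of_le_of_le tendsto_const_nhds (by simpa using h1.add h2)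
    (fun _ => zero_le) fun n => measure_union_le _ _

end Solutions

end LinProg

/-! ### The limit theorem -/

theorem theorem3p1 {m d m₀ : ℕ} (hm : m₀ ≤ m)
    (A : Matrix (Fin m) (Fin d) ℝ) (hA : A.rank = m) (b : Fin m → ℝ) (c : Fin d → ℝ)
    -- (A2): the optimal solution exists and is unique
    (xstar : Fin d → ℝ) (hA2 : optSet A c b = {xstar})
    {Ω Ω' : Type*} [MeasurableSpace Ω] [MeasurableSpace Ω']
    (P : Measure Ω) [IsProbabilityMeasure P] (P' : Measure Ω') [IsProbabilityMeasure P']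
    (r : ℕ → ℝ) (hr : Tendsto r atTop atTop)
    -- `bn₀ n` is the random part (the first `m₀` coordinates) of `b_n`, which is
    -- `overwrite b (bn₀ n ω)`; `G₀` is the random part of `G`, which is `overwrite 0 (G₀ ω')`
    (bn₀ : ℕ → Ω → Fin m₀ → ℝ) (hbn₀ : ∀ n, Measurable (bn₀ n))
    (G₀ : Ω' → Fin m₀ → ℝ)
    -- (B1)
    (hB1 : TendstoInDistribution (fun n ω => r n • (bn₀ n ω - firstCoords hm b)) atTop G₀
      (fun _ => P) P')
    (hG₀ : P'.map G₀ ≪ volume)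
    -- (B2)
    (hB2 : Tendsto (fun n => P {ω | (optSet A c (overwrite b (bn₀ n ω))).Nonempty}) atTop (𝓝 1))
    -- `xn n` is any measurable choice of an optimal solution for the right-hand side `b_n`
    (xn : ℕ → Ω → Fin d → ℝ) (hxn : ∀ n, Measurable (xn n))
    (hxn_opt : ∀ n ω, (optSet A c (overwrite b (bn₀ n ω))).Nonempty →
      xn n ω ∈ optSet A c (overwrite b (bn₀ n ω))) :
    -- the cones `H_I`
    (∀ I ∈ optBases A c b,
      IsClosed (limitCone m₀ A xstar I) ∧ Convex ℝ (limitCone m₀ A xstar I) ∧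
      0 ∈ limitCone m₀ A xstar I ∧
      (∀ t : ℝ, 0 ≤ t → ∀ v ∈ limitCone m₀ A xstar I, t • v ∈ limitCone m₀ A xstar I) ∧
      (supp xstar).card ≤ m ∧
      IsInterHalfSpaces m (m - (supp xstar).card) (limitCone m₀ A xstar I)) ∧
    -- the general limit law
    (∀ (αn : (𝒦 : Finset (Finset (Fin d))) → ℕ → Ω → 𝒦 → ℝ)
      (α : (𝒦 : Finset (Finset (Fin d))) → Ω' → 𝒦 → ℝ),
      (∀ 𝒦 ⊆ optBases A c b, 𝒦.Nonempty →
        (∀ n ω, αn 𝒦 n ω ∈ stdSimplex ℝ 𝒦) ∧ (∀ ω', α 𝒦 ω' ∈ stdSimplex ℝ 𝒦) ∧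
        -- `αn 𝒦 n` are the weights of the chosen solution when exactly the bases in `𝒦` are optimal
        (∀ n ω, ActiveBases A c 𝒦 (overwrite b (bn₀ n ω)) →
          xn n ω = weightedSol A 𝒦 (αn 𝒦 n ω) (overwrite b (bn₀ n ω))) ∧
        -- joint convergence in distribution of `(α_n^𝒦, G_n)` to `(α^𝒦, G)`
        TendstoInDistribution
          (fun n ω => (αn 𝒦 n ω, r n • (overwrite b (bn₀ n ω) - b))) atTop
          (fun ω' => (α 𝒦 ω', (overwrite 0 (G₀ ω') : Fin m → ℝ))) (fun _ => P) P') →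
      TendstoInDistribution (fun n ω => r n • (xn n ω - xstar)) atTop
        (fun ω' => limitM A xstar (optBases A c b) (fun 𝒦 => α 𝒦 ω') (G₀ ω'))
        (fun _ => P) P') ∧
    -- the nondegenerate case
    (¬ IsDegenerate m xstar →
      ∃ I₁ : Finset (Fin d), optBases A c b = {I₁} ∧
        (∀ I, IsBasis A I ∧ primalSol A I b = xstar ↔ I = I₁) ∧
        TendstoInDistribution (fun n ω => r n • (xn n ω - xstar)) atTop
          (fun ω' => primalSol A I₁ (overwrite 0 (G₀ ω'))) (fun _ => P) P' ∧
        -- `v ↦ x(I₁, v)` is linear and invertible onto the vectors supported in `I₁`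
        IsLinearMap ℝ (primalSol A I₁) ∧
        Set.BijOn (primalSol A I₁) Set.univ {x | ∀ i ∉ I₁, x i = 0} ∧
        (HasGaussianLaw (fun ω' => (overwrite 0 (G₀ ω') : Fin m → ℝ)) P' →
          HasGaussianLaw (fun ω' => primalSol A I₁ (overwrite 0 (G₀ ω'))) P')) := by
  have hgood := eventually_optBases_subset hA2
  have hbad := tendsto_measure_exceptional hm hA hr hbn₀ hB1 hB2 hgood
  have hYm : ∀ n, AEMeasurable (fun ω => r n • (xn n ω - xstar)) P := fun n =>
    (((hxn n).sub measurable_const).const_smul (r n)).aemeasurable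
  refine ⟨fun I hI => ?_, fun αn α hα => ?_, fun hnd => ?_⟩
  · have hsupp := supp_subset_of_primalSol_eq (primalSol_eq_of_mem_optBases hA2 hI)
    have hbasis := (mem_optBases.1 hI).1.1
    exact ⟨isClosed_limitCone _, convex_limitCone _, zero_mem_limitCone _,
      fun t ht v hv => smul_mem_limitCone ht hv, hbasis.1 ▸ Finset.card_le_card hsupp,
      hbasis.isInterHalfSpaces_limitCone hsupp⟩
  · have hconv : ∀ 𝒦 ⊆ optBases A c b, TendstoInDistribution
        (fun n ω => (αn 𝒦 n ω, r n • (bn₀ n ω - firstCoords hm b))) atTop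
        (fun ω' => (α 𝒦 ω', G₀ ω')) (fun _ => P) P' := by
      intro 𝒦 h𝒦
      -- The hypothesis on weights concerns only nonempty 𝒦; for ∅ the weights live in a one-point
      -- space and `hB1` suffices.
      rcases 𝒦.eq_empty_or_nonempty with rfl | hne
      · have h := hB1.continuous_comp
          (g := fun v => ((0 : (∅ : Finset (Finset (Fin d))) → ℝ), v)) (by fun_prop)
        have e : ∀ u : (∅ : Finset (Finset (Fin d))) → ℝ, u = 0 := fun u => Subsingleton.elim _ _
        simp only [e (αn ∅ _ _), e (α ∅ _)]
        exact h
      · have hcont : Continuous (firstCoords hm) := continuous_pi fun j => continuous_apply _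
        have h := (hα 𝒦 h𝒦 hne).2.2.2.continuous_comp
          (g := fun p => (p.1, firstCoords hm p.2)) (by fun_prop)
        have e : ∀ n ω, firstCoords hm (r n • (overwrite b (bn₀ n ω) - b)) =
            r n • (bn₀ n ω - firstCoords hm b) := fun n ω => by
          rw [overwrite_sub_self hm, ← isLinearMap_overwrite_zero.map_smul, firstCoords_overwrite]
        simpa only [Function.comp_def, e, firstCoords_overwrite] using h
    refine tendstoInDistribution_of_eq_off (tendstoInDistribution_limitM hG₀ hconv) hYm hbad ?_
    filter_upwards [hr.eventually_gt_atTop 0] with n hn ω hω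
    simp only [Set.mem_union, Set.mem_compl_iff, Set.mem_ofPred_eq, not_or, not_not] at hω
    obtain ⟨hne, hsub, hpos⟩ := hω
    -- Here 𝒦 is the random set of bases optimal at b_n, nonempty because an optimum exists.
    obtain ⟨hαn, -, hrep, -⟩ := hα _ hsub ((optSet_nonempty_iff hA).1 hne)
    exact smul_sub_eq_limitM (α := fun 𝒦 => αn 𝒦 n ω) hm hA2 hsub hpos (hαn n ω) (hrep n ω rfl) hn
  · obtain ⟨I₁, hI₁⟩ := (optSet_nonempty_iff hA).1 (hA2 ▸ Set.singleton_nonempty xstar)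
    have hbasis := (mem_optBases.1 hI₁).1.1
    have hI₁b := primalSol_eq_of_mem_optBases hA2 hI₁
    have hsupp : ∀ I, IsBasis A I → primalSol A I b = xstar → supp xstar = I := fun I hI h =>
      Finset.eq_of_subset_of_card_le (supp_subset_of_primalSol_eq h) (hI.1 ▸ not_lt.1 hnd)
    have hs₁ := hsupp I₁ hbasis hI₁b
    refine ⟨I₁, ?_, fun I => ⟨fun h => ?_, fun h => ?_⟩, ?_, isLinearMap_primalSol A I₁,
      hbasis.bijOn_primalSol, fun hG => hG.map_fun (primalSolCLM A I₁)⟩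
    · refine Finset.eq_singleton_iff_unique_mem.2 ⟨hI₁, fun I hI => ?_⟩
      rw [← hs₁, hsupp I (mem_optBases.1 hI).1.1 (primalSol_eq_of_mem_optBases hA2 hI)]
    · rw [← hs₁, hsupp I h.1 h.2]
    · subst h
      exact ⟨hbasis, hI₁b⟩
    · have hcont : Continuous fun v : Fin m₀ → ℝ => primalSol A I₁ (overwrite 0 v) := by fun_prop
      have hlim := hB1.continuous_comp hcont
      refine tendstoInDistribution_of_eq_off (Z' := fun ω' => primalSol A I₁ (overwrite 0 (G₀ ω')))
        hlim hYm hbad (Eventually.of_forall fun n ω hω => ?_)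
      simp only [Set.mem_union, Set.mem_compl_iff, Set.mem_ofPred_eq, not_or, not_not] at hω
      obtain ⟨hne, -, hpos⟩ := hω
      -- Nondegeneracy enters here: `I₁` is the support of x⋆, so positivity on the support is full
      -- feasibility.
      have hfeas : 0 ≤ primalSol A I₁ (overwrite b (bn₀ n ω)) := fun i => by
        by_cases hi : i ∈ I₁
        · exact (hpos I₁ hI₁ i (hs₁ ▸ hi)).le
        · exact (primalSol_eq_zero_of_notMem _ hi).ge
      have hx := eq_primalSol_of_mem_optSet hA2 hI₁ hs₁.ge hfeas (hxn_opt n ω hne)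
      rw [hx, Function.comp_apply, isLinearMap_overwrite_zero.map_smul, primalSol_smul,
        ← overwrite_sub_self hm, primalSol_sub, hI₁b]
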